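/- Let $G$ be an agrarian group, i.e. a group whose integral group ring $\mathbb{Z}G$ embeds into a skew-field, and suppose that the abelianisation of $G$ is finitely generated. Let $H$ be the free part of the abelianisation of $G$ (its quotient by its torsion subgroup), let $\alpha\colon G\to H$ be the projection, let $K=\ker\alpha$, and let $s\colon H\to G$ be a set-theoretic section of $\alpha$. A *$G$-equivariant embedding* of $\mathbb{Z}K$ into a skew-field $\mathbb{K}$ is an injective ring homomorphism $\mathbb{Z}K\hookrightarrow\mathbb{K}$ together with an action of $G$ on $\mathbb{K}$ by ring automorphisms which extends the conjugation action of $G$ on $\mathbb{Z}K$ and for which every $k\in K$ acts as conjugation by $k\in\mathbb{K}^\times$. (If $\mathbb{Z}G$ embeds into $\mathbb{K}$, then $G$ acting by conjugation is an example.) Given one, let $\mathbb{K}H$ be the twisted group ring with $rh\cdot r'h'=r\,(s(h).r')\,\big(s(h)s(h')s(hh')^{-1}\big)\,hh'$, which contains $\mathbb{Z}G$ via $g\mapsto \big(g\,s(\alpha(g))^{-1}\big)\,\alpha(g)$, and let $\mathcal{D}$ be its Ore localisation, a skew-field. Let $\mathcal{P}(H)$ be the Grothendieck group of the monoid, under Minkowski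 sum, of non-empty integral polytopes (convex hulls of non-empty finite subsets of $H$) in $H\otimes_{\mathbb{Z}}\mathbb{R}$, and let $\mathcal{P}_T(H)$ be its quotient by the subgroup of formal differences of singletons. For $p\in\mathbb{K}H\setminus\{0\}$ let $P(p)$ be the convex hull of the support of $p$, and put $P(pq^{-1})=P(p)-P(q)\in\mathcal{P}(H)$ for the class of $pq^{-1}$ in $\mathcal{D}^\times/[\mathcal{D}^\times,\mathcal{D}^\times]$. The Newton polytope of an invertible square matrix $A$ over $\mathbb{Z}G$ is $P(A)=P(\det(A\otimes\mathcal{D}))$, where $\det$ is the Dieudonné determinant. Let $\mathrm{Wh}(G)$ be the quotient of $K_1(\mathbb{Z}G)=\mathrm{GL}(\mathbb{Z}G)^{\mathrm{ab}}$ by the subgroup generated by the $1\times1$ matrices $(\pm g)$, $g\in G$. The Newton polytope (up to translation) of $w\in\mathrm{Wh}(G)$ is the class of $P(A)$ in $\mathcal{P}_T(H)$, where $A$ is any invertible matrix over $\mathbb{Z}G$ representing $w$. Then a $G$-equivariant embedding of $\mathbb{Z}K$ into a skew-field exists, and for every such embedding and every section $s$, the Newton polytope (up to translation) of every element of $\mathrm{Wh}(G)$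 exists, does not depend on the choices of $A$, $p$ and $q$, and is a singleton. -/

import Mathlib

open scoped Pointwise TensorProduct nonZeroDivisors

/-! ## Twisted group rings -/

/-- Structure functions `φ : H → Aut(R)`, `μ : H × H → Rˣ` of a twisted group ring `R H`
(not assumed to be normalised). -/
structure StructureFunctions (R H : Type*) [Ring R] [Group H] where
  φ : H → RingAut R
  μ : H → H → Rˣ
  φ_comp : ∀ (g g' : H) (r : R),
    φ g (φ g' r) = (μ g g' : R) * φ (g * g') r * ((μ g g')⁻¹ : Rˣ)
  cocycle : ∀ g g' g'' : H,
    (μ g g' : R) * μ (g * g') g'' = φ g (μ g' g'' : R) * μ g (g' * g'')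

/-- The twisted group ring `R H`: finitely supported functions `H → R`. -/
@[ext] structure TwistedGroupRing {R H : Type*} [Ring R] [Group H] (σ : StructureFunctions R H) where
  coeff : H →₀ R

namespace TwistedGroupRing

section Ring

variable {R H : Type*} [Ring R] [Group H] (σ : StructureFunctions R H)

/-- An element of the twisted group ring is the same as a finitely supported function. -/
def coeffEquiv : TwistedGroupRing σ ≃ (H →₀ R) where
  toFun := coeff
  invFun := mk

/-- Pointwise addition. -/
noncomputable instance : AddCommGroup (TwistedGroupRing σ) := (coeffEquiv σ).addCommGroup

/-- The left `R`-module structure. -/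
noncomputable instance : Module R (TwistedGroupRing σ) := (coeffEquiv σ).module R

/-- The element `r h`. -/
noncomputable def single (h : H) (r : R) : TwistedGroupRing σ := ⟨Finsupp.single h r⟩

variable {σ} in
/-- The finite support. -/
def support (x : TwistedGroupRing σ) : Finset H := x.coeff.support

/-- The twisted convolution `r g * r' g' = r φ(g)(r') μ(g, g') g g'`, extended biadditively. -/
noncomputable instance : Mul (TwistedGroupRing σ) where
  mul x y := ⟨x.coeff.sum fun g r => y.coeff.sum fun g' r' =>
    Finsupp.single (g * g') (r * σ.φ g r' * σ.μ g g')⟩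

/-- The unit `μ(1,1)⁻¹ 1`. It is the usual one if `μ` is normalised. -/
noncomputable instance : One (TwistedGroupRing σ) where
  one := single σ 1 ((σ.μ 1 1)⁻¹ : Rˣ)

theorem one_def : (1 : TwistedGroupRing σ) = single σ 1 ((σ.μ 1 1)⁻¹ : Rˣ) := rfl

@[simp] theorem coeff_zero : (0 : TwistedGroupRing σ).coeff = 0 := rfl

variable {σ} in
@[simp] theorem coeff_add (x y : TwistedGroupRing σ) : (x + y).coeff = x.coeff + y.coeff := rfl

variable {σ} in
@[simp] theorem coeff_smul (r : R) (x : TwistedGroupRing σ) : (r • x).coeff = r • x.coeff := rfl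

@[simp] theorem coeff_single (h : H) (r : R) : (single σ h r).coeff = Finsupp.single h r := rfl

variable {σ} in
theorem coeff_mul (x y : TwistedGroupRing σ) :
    (x * y).coeff = x.coeff.sum fun g r => y.coeff.sum fun g' r' =>
      Finsupp.single (g * g') (r * σ.φ g r' * σ.μ g g') := rfl

@[simp] theorem single_zero (h : H) : single σ h 0 = 0 := by ext1; simp

theorem single_add (h : H) (r s : R) : single σ h (r + s) = single σ h r + single σ h s := by
  ext1; simp

theorem induction {p : TwistedGroupRing σ → Prop} (x : TwistedGroupRing σ) (h0 : p 0)
    (hadd : ∀ x y, p x → p y → p (x + y)) (hs : ∀ h r, p (single σ h r)) : p x :=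
  Finsupp.induction_linear (motive := fun f => p ⟨f⟩) x.coeff h0
    (fun f g hf hg => hadd ⟨f⟩ ⟨g⟩ hf hg) hs

theorem single_mul_single (g g' : H) (r r' : R) :
    single σ g r * single σ g' r' = single σ (g * g') (r * σ.φ g r' * σ.μ g g') := by
  ext1
  simp [coeff_mul]

theorem add_mul' (x y z : TwistedGroupRing σ) : (x + y) * z = x * z + y * z := by
  ext1
  simp only [coeff_mul, coeff_add]
  refine Finsupp.sum_add_index' (fun g => ?_) (fun g r s => ?_)
  · simp [Finsupp.sum]
  · simp only [add_mul, Finsupp.single_add]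
    exact Finsupp.sum_add

theorem mul_add' (x y z : TwistedGroupRing σ) : x * (y + z) = x * y + x * z := by
  ext1
  simp only [coeff_mul, coeff_add]
  rw [← Finsupp.sum_add]
  refine Finsupp.sum_congr fun g _ => ?_
  refine Finsupp.sum_add_index' (fun g => ?_) (fun g r s => ?_)
  · simp
  · simp [mul_add, add_mul]

theorem zero_mul' (x : TwistedGroupRing σ) : 0 * x = 0 := by
  ext1; simp [coeff_mul]

theorem mul_zero' (x : TwistedGroupRing σ) : x * 0 = 0 := by
  have h := mul_add' σ x 0 0
  rw [add_zero] at h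
  simpa using h

theorem φ_one (r : R) : σ.φ 1 r = (σ.μ 1 1 : R) * r * ((σ.μ 1 1)⁻¹ : Rˣ) := by
  obtain ⟨s, rfl⟩ := (σ.φ 1).surjective r
  rw [σ.φ_comp, one_mul]

theorem μ_one_left (h : H) : σ.μ 1 h = σ.μ 1 1 := by
  have h1 := σ.cocycle 1 1 h
  rw [one_mul, one_mul] at h1
  have h2 := (σ.μ 1 h).isUnit.mul_right_cancel h1
  rw [φ_one, mul_assoc, Units.ext_iff] at *
  have h3 := (σ.μ 1 1).isUnit.mul_left_cancel ((mul_one _).trans h2)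
  rw [eq_comm, Units.mul_inv_eq_one] at h3
  exact h3

theorem μ_one_right (h : H) : (σ.μ h 1 : R) = σ.φ h (σ.μ 1 1 : R) := by
  have h1 := σ.cocycle h 1 1
  rw [mul_one, mul_one] at h1
  exact (σ.μ h 1).isUnit.mul_right_cancel h1

noncomputable instance : Ring (TwistedGroupRing σ) where
  left_distrib := mul_add' σ
  right_distrib := add_mul' σ
  zero_mul := zero_mul' σ
  mul_zero := mul_zero' σ
  mul_assoc x y z := by
    induction x using induction with
    | h0 => simp only [zero_mul']
    | hadd x x' hx hx' => simp only [add_mul', hx, hx']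
    | hs g r =>
    induction y using induction with
    | h0 => simp only [zero_mul', mul_zero']
    | hadd x x' hx hx' => simp only [add_mul', mul_add', hx, hx']
    | hs g' r' =>
    induction z using induction with
    | h0 => simp only [mul_zero']
    | hadd x x' hx hx' => simp only [mul_add', hx, hx']
    | hs g'' r'' =>
    simp only [single_mul_single, mul_assoc, map_mul, σ.φ_comp]
    rw [← σ.cocycle]
    simp only [Units.inv_mul_cancel_left]
  one_mul x := by
    induction x using induction with
    | h0 => simp only [mul_zero']
    | hadd x x' hx hx' => simp only [mul_add', hx, hx']
    | hs g r =>
    rw [one_def, single_mul_single, one_mul, φ_one, μ_one_left σ g]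
    simp [mul_assoc]
  mul_one x := by
    induction x using induction with
    | h0 => simp only [zero_mul']
    | hadd x x' hx hx' => simp only [add_mul', hx, hx']
    | hs g r =>
    rw [one_def, single_mul_single, mul_one, μ_one_right, mul_assoc, ← map_mul]
    simp
  neg_add_cancel := neg_add_cancel
  zsmul := fun n x => n • x
  zsmul_zero' := SubNegMonoid.zsmul_zero'
  zsmul_succ' := SubNegMonoid.zsmul_succ'
  zsmul_neg' := SubNegMonoid.zsmul_neg'
  nsmul := fun n x => n • x
  nsmul_zero := AddMonoid.nsmul_zero
  nsmul_succ := AddMonoid.nsmul_succ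
  sub_eq_add_neg := sub_eq_add_neg

theorem smul_mul' (r : R) (x y : TwistedGroupRing σ) : (r • x) * y = r • (x * y) := by
  induction x using induction with
  | h0 => simp
  | hadd x x' hx hx' => simp only [smul_add, add_mul, hx, hx']
  | hs g a =>
  induction y using induction with
  | h0 => simp
  | hadd x x' hx hx' => simp only [smul_add, mul_add, hx, hx']
  | hs g' a' =>
  have e : ∀ (h : H) (b : R), r • single σ h b = single σ h (r * b) :=
    fun h b => by ext1; simp
  simp only [e, single_mul_single, mul_assoc]

variable {σ} in
theorem support_mul_subset [DecidableEq H] (x y : TwistedGroupRing σ) :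
    (x * y).support ⊆ x.support * y.support := by
  rw [support, coeff_mul]
  refine Finsupp.support_sum.trans (Finset.biUnion_subset.2 fun g hg => ?_)
  refine Finsupp.support_sum.trans (Finset.biUnion_subset.2 fun g' hg' => ?_)
  exact Finsupp.support_single_subset.trans
    (Finset.singleton_subset_iff.2 (Finset.mul_mem_mul hg hg'))

variable {σ} in
theorem coeff_mul_of_uniqueMul (x y : TwistedGroupRing σ) {a b : H}
    (ha : a ∈ x.support) (hb : b ∈ y.support) (hab : UniqueMul x.support y.support a b) :
    (x * y).coeff (a * b) = x.coeff a * σ.φ a (y.coeff b) * σ.μ a b := by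
  classical
  change a ∈ x.coeff.support at ha
  change b ∈ y.coeff.support at hb
  rw [coeff_mul, Finsupp.sum_apply, Finsupp.sum, Finset.sum_eq_single_of_mem a ha,
    Finsupp.sum_apply, Finsupp.sum, Finset.sum_eq_single_of_mem b hb, Finsupp.single_eq_same]
  · intro b' hb' hne
    rw [Finsupp.single_eq_of_ne]
    exact fun h => hne (mul_left_cancel h).symm
  · intro a' ha' hne
    rw [Finsupp.sum_apply]
    refine Finset.sum_eq_zero fun b' hb' => ?_
    beta_reduce
    rw [Finsupp.single_eq_of_ne]
    exact fun h => hne (hab ha' hb' h.symm).1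

end Ring

/-! ## The Ore localisation -/

section Ore

variable {R H : Type*} [DivisionRing R]

instance [Group H] (σ : StructureFunctions R H) : Nontrivial (TwistedGroupRing σ) :=
  ⟨1, 0, fun h => by
    have := congrArg (fun x => x.coeff 1) h
    simp [one_def] at this⟩

instance [Group H] [UniqueProds H] (σ : StructureFunctions R H) :
    NoZeroDivisors (TwistedGroupRing σ) where
  eq_zero_or_eq_zero_of_mul_eq_zero {x y} h := by
    by_contra! hxy
    have hx : x.support.Nonempty :=
      Finsupp.support_nonempty_iff.2 fun h => hxy.1 (TwistedGroupRing.ext h)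
    have hy : y.support.Nonempty :=
      Finsupp.support_nonempty_iff.2 fun h => hxy.2 (TwistedGroupRing.ext h)
    obtain ⟨a, ha, b, hb, hab⟩ := UniqueProds.uniqueMul_of_nonempty hx hy
    have h1 := coeff_mul_of_uniqueMul x y ha hb hab
    rw [h, coeff_zero, Finsupp.zero_apply, eq_comm] at h1
    have hxa : x.coeff a ≠ 0 := Finsupp.mem_support_iff.1 ha
    have hyb : y.coeff b ≠ 0 := Finsupp.mem_support_iff.1 hb
    simp [hxa, hyb] at h1

/-- In a finitely generated free abelian group, finite sets `U` admit finite sets `F` with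
`|F U| < 2 |F|`. -/
theorem exists_card_mul_lt [CommGroup H] [Group.FG H] [IsMulTorsionFree H] [DecidableEq H]
    (U : Finset H) : ∃ F : Finset H, (F * U).card < 2 * F.card := by
  classical
  let ι := Module.Free.ChooseBasisIndex ℤ (Additive H)
  let e : Additive H ≃ₗ[ℤ] (ι → ℤ) := (Module.Free.chooseBasis ℤ (Additive H)).equivFun
  obtain ⟨m, hm⟩ : ∃ m : ℕ, ∀ u ∈ U, ∀ i, |e (Additive.ofMul u) i| ≤ m := by
    refine ⟨∑ u ∈ U, ∑ i, (e (Additive.ofMul u) i).natAbs, fun u hu i => ?_⟩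
    rw [Int.abs_eq_natAbs]
    exact_mod_cast (Finset.single_le_sum (f := fun i => (e (Additive.ofMul u) i).natAbs)
      (fun _ _ => Nat.zero_le _) (Finset.mem_univ i)).trans
      (Finset.single_le_sum (f := fun u => ∑ i, (e (Additive.ofMul u) i).natAbs)
      (fun _ _ => Nat.zero_le _) hu)
  let n := Fintype.card ι
  let N : ℕ := 4 * m * n + 1
  let t : (ι → ℤ) → H := fun v => (e.symm v).toMul
  have ht : Function.Injective t := fun v w h => e.symm.injective (Additive.toMul.injective h)
  let F : Finset H := (Finset.Icc (fun _ : ι => (0 : ℤ)) (fun _ => (N : ℤ) - 1)).image t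
  have hF : F.card = N ^ n := by
    rw [Finset.card_image_of_injective _ ht, Pi.card_Icc]
    simp [n]
  have hFU : F * U ⊆ (Finset.Icc (fun _ : ι => -(m : ℤ)) (fun _ => (N : ℤ) - 1 + m)).image t := by
    intro x hx
    obtain ⟨f, hf, u, hu, rfl⟩ := Finset.mem_mul.1 hx
    obtain ⟨v, hv, rfl⟩ := Finset.mem_image.1 hf
    refine Finset.mem_image.2 ⟨v + e (Additive.ofMul u), ?_, ?_⟩
    · rw [Finset.mem_Icc] at hv ⊢
      refine ⟨fun i => ?_, fun i => ?_⟩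
      · have h1 := hv.1 i
        have h2 := (abs_le.1 (hm u hu i)).1
        simp only [Pi.add_apply] at *
        linarith
      · have h1 := hv.2 i
        have h2 := (abs_le.1 (hm u hu i)).2
        simp only [Pi.add_apply] at *
        linarith
    · simp [t]
  refine ⟨F, (Finset.card_le_card hFU).trans_lt ?_⟩
  rw [hF, Finset.card_image_of_injective _ ht, Pi.card_Icc]
  have h3 : ((N : ℤ) - 1 + m + 1 - (-(m : ℤ))).toNat = N + 2 * m := by omega
  simp only [Int.card_Icc, h3, Finset.prod_const, Finset.card_univ]
  change (N + 2 * m) ^ n < 2 * N ^ n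
  have hM : (0 : ℝ) < (N + 2 * m : ℝ) := by positivity
  have hN : (N : ℝ) = 4 * m * n + 1 := by simp [N]
  have hle : (2 * m : ℝ) / (N + 2 * m) ≤ 1 := by
    rw [div_le_one hM]
    have : (0 : ℝ) ≤ N := by positivity
    linarith
  have hB := one_add_mul_le_pow (a := -((2 * m : ℝ) / (N + 2 * m))) (by linarith) n
  have h4 : (1 : ℝ) + -((2 * m : ℝ) / (N + 2 * m)) = N / (N + 2 * m) := by
    field_simp
    ring
  have h5 : (1 : ℝ) / 2 < 1 + n * -((2 * m : ℝ) / (N + 2 * m)) := by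
    have : n * ((2 * m : ℝ) / (N + 2 * m)) < 1 / 2 := by
      rw [mul_div_assoc', div_lt_div_iff₀ hM two_pos, hN]
      have : (0 : ℝ) ≤ m := by positivity
      linarith
    linarith
  rw [h4, div_pow] at hB
  have h6 := h5.trans_le hB
  rw [div_lt_div_iff₀ two_pos (pow_pos hM n), one_mul, mul_comm _ (2 : ℝ)] at h6
  exact_mod_cast h6

/-- The left Ore condition. -/
theorem exists_ore [CommGroup H] [Group.FG H] [IsMulTorsionFree H] (σ : StructureFunctions R H)
    (p r : TwistedGroupRing σ) (hr : r ≠ 0) :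
    ∃ q s : TwistedGroupRing σ, s ≠ 0 ∧ s * p = q * r := by
  classical
  obtain ⟨F, hF⟩ := exists_card_mul_lt (p.support ∪ r.support)
  let V : Submodule R (H →₀ R) := Finsupp.supported R R (F : Set H)
  let W : Submodule R (H →₀ R) :=
    Finsupp.supported R R (↑(F * (p.support ∪ r.support)) : Set H)
  let L : (V × V) →ₗ[R] (H →₀ R) :=
    { toFun := fun v => ((⟨v.1⟩ : TwistedGroupRing σ) * r - ⟨v.2⟩ * p).coeff
      map_add' := fun v w => by
        have h1 : (⟨(v + w).1⟩ : TwistedGroupRing σ) = ⟨v.1⟩ + ⟨w.1⟩ := rfl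
        have h2 : (⟨(v + w).2⟩ : TwistedGroupRing σ) = ⟨v.2⟩ + ⟨w.2⟩ := rfl
        rw [h1, h2, add_mul, add_mul, add_sub_add_comm]
        rfl
      map_smul' := fun c v => by
        have h1 : (⟨(c • v).1⟩ : TwistedGroupRing σ) = c • ⟨v.1⟩ := rfl
        have h2 : (⟨(c • v).2⟩ : TwistedGroupRing σ) = c • ⟨v.2⟩ := rfl
        rw [h1, h2, smul_mul', smul_mul', ← smul_sub]
        rfl }
  have hsub : ∀ (v : V) (z : TwistedGroupRing σ), z.support ⊆ p.support ∪ r.support →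
      ((⟨v⟩ : TwistedGroupRing σ) * z).coeff ∈ W := by
    intro v z hz
    refine (Finsupp.mem_supported R _).2 (Finset.coe_subset.2 ?_)
    refine (support_mul_subset _ z).trans (Finset.mul_subset_mul ?_ hz)
    exact Finset.coe_subset.1 ((Finsupp.mem_supported R _).1 v.2)
  have hL : ∀ v, L v ∈ W := fun v =>
    W.sub_mem (hsub v.1 r Finset.subset_union_right) (hsub v.2 p Finset.subset_union_left)
  have fin : ∀ S : Finset H, Module.Finite R (Finsupp.supported R R (S : Set H)) ∧
      Module.finrank R (Finsupp.supported R R (S : Set H)) = S.card := fun S => by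
    have e := Finsupp.supportedEquivFinsupp (M := R) (R := R) (S : Set H)
    refine ⟨Module.Finite.equiv e.symm, ?_⟩
    rw [e.finrank_eq]
    simp
  have := (fin F).1
  have := (fin (F * (p.support ∪ r.support))).1
  have hlt : Module.finrank R W < Module.finrank R (V × V) := by
    have : Module.Free R V := Module.Free.of_divisionRing R V
    rw [Module.finrank_prod, (fin F).2, (fin _).2, ← two_mul]
    exact hF
  have hker : LinearMap.ker (L.codRestrict W hL) ≠ ⊥ :=
    LinearMap.ker_ne_bot_of_finrank_lt (K := R) (V := V × V) (V₂ := W) hlt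
  obtain ⟨v, hv, hv0⟩ := (Submodule.ne_bot_iff _).1 hker
  have hv1 : L v = 0 := congrArg Subtype.val (LinearMap.mem_ker.1 hv)
  have hv2 : (⟨v.1⟩ : TwistedGroupRing σ) * r - ⟨v.2⟩ * p = 0 := TwistedGroupRing.ext hv1
  rw [sub_eq_zero] at hv2
  refine ⟨⟨v.1⟩, ⟨v.2⟩, fun hs => hv0 ?_, hv2.symm⟩
  rw [hs, zero_mul] at hv2
  have h1 := (mul_eq_zero.1 hv2).resolve_right hr
  exact Prod.ext (Subtype.ext (congrArg coeff h1)) (Subtype.ext (congrArg coeff hs))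

variable [CommGroup H] [Group.FG H] [IsMulTorsionFree H] (σ : StructureFunctions R H)

/-- A twisted group ring of a finitely generated free abelian group over a skew field is an
Ore domain. -/
noncomputable instance : OreLocalization.OreSet (TwistedGroupRing σ)⁰ :=
  Classical.choice <| OreLocalization.nonempty_oreSet_iff_of_noZeroDivisors.2 fun p r => by
    obtain ⟨q, s, hs, h⟩ := exists_ore σ p r (nonZeroDivisors.ne_zero r.2)
    exact ⟨q, ⟨s, mem_nonZeroDivisors_of_ne_zero hs⟩, h⟩

/-- The Ore localisation of the twisted group ring; this is a skew field. -/
abbrev OreField : Type _ := OreLocalization (TwistedGroupRing σ)⁰ (TwistedGroupRing σ)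

/-- The canonical embedding into the Ore localisation. -/
noncomputable def toOreField : TwistedGroupRing σ →+* OreField σ :=
  OreLocalization.numeratorRingHom

end Ore

end TwistedGroupRing

/-! ## The polytope group -/

section Polytopes

variable (H : Type*) [CommGroup H]

/-- `H₁(H; ℝ) = ℝ ⊗ H`. -/
abbrev RealHomology : Type _ := ℝ ⊗[ℤ] Additive H

variable {H} in
/-- The image of `h` in `H₁(H; ℝ)`. -/
def latticePoint (h : H) : RealHomology H := (1 : ℝ) ⊗ₜ[ℤ] Additive.ofMul h

/-- The monoid of non-empty integral polytopes in `H₁(H; ℝ)`, that is, of convex hulls of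
non-empty finite sets of lattice points, with the Minkowski sum. -/
noncomputable def integralPolytopes : AddSubmonoid (Set (RealHomology H)) where
  carrier := {P | ∃ S : Finset H, S.Nonempty ∧ P = convexHull ℝ (latticePoint '' (S : Set H))}
  zero_mem' := ⟨{1}, by simp, by simp [latticePoint, Set.singleton_zero]⟩
  add_mem' := by
    classical
    rintro _ _ ⟨S, hS, rfl⟩ ⟨T, hT, rfl⟩
    refine ⟨S * T, hS.mul hT, ?_⟩
    rw [← convexHull_add, Finset.coe_mul]
    congr 1
    ext v
    simp only [Set.mem_add, Set.mem_image, Set.mem_mul]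
    constructor
    · rintro ⟨_, ⟨a, ha, rfl⟩, _, ⟨b, hb, rfl⟩, rfl⟩
      exact ⟨a * b, ⟨a, ha, b, hb, rfl⟩, by simp [latticePoint, TensorProduct.tmul_add]⟩
    · rintro ⟨_, ⟨a, ha, b, hb, rfl⟩, rfl⟩
      exact ⟨_, ⟨a, ha, rfl⟩, _, ⟨b, hb, rfl⟩, by simp [latticePoint, TensorProduct.tmul_add]⟩

/-- Non-empty integral polytopes in `H₁(H; ℝ)`. -/
abbrev IntegralPolytope : Type _ := integralPolytopes H

/-- The polytope group `𝒫(H)`: the Grothendieck group of the monoid of non-empty integral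
polytopes. -/
abbrev PolytopeGroup : Type _ := Algebra.GrothendieckAddGroup (IntegralPolytope H)

variable {H} in
/-- The class of a polytope in `𝒫(H)`. -/
noncomputable def IntegralPolytope.toGroup (P : IntegralPolytope H) : PolytopeGroup H :=
  Algebra.GrothendieckAddGroup.of P

variable {H} in
/-- The polytope consists of a single point. -/
def IntegralPolytope.IsSingleton (P : IntegralPolytope H) : Prop :=
  ∃ v : RealHomology H, (P : Set (RealHomology H)) = {v}

/-- The subgroup of `𝒫(H)` of formal differences of singletons. -/
noncomputable def translations : AddSubgroup (PolytopeGroup H) :=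
  AddSubgroup.closure {x | ∃ P Q : IntegralPolytope H,
    P.IsSingleton ∧ Q.IsSingleton ∧ x = P.toGroup - Q.toGroup}

/-- The group `𝒫_T(H)` of formal differences of polytopes up to translation. -/
abbrev PolytopeGroupT : Type _ := PolytopeGroup H ⧸ translations H

variable {H} in
/-- The element of `𝒫_T(H)` is represented by a singleton. -/
def PolytopeGroupT.IsSingleton (x : PolytopeGroupT H) : Prop :=
  ∃ P : IntegralPolytope H, P.IsSingleton ∧ x = QuotientAddGroup.mk P.toGroup

end Polytopes

/-! ## The Dieudonné determinant -/

section Dieudonne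

variable {D : Type*} [DivisionRing D]

open Classical in
/-- The canonical representative of the Dieudonné determinant. If the last row is non-zero, then
the last column of `A` is interchanged with the `j`-th one, where `j` is maximal such that the
`j`-th entry of the last row is non-zero (nothing happens if `j` is the last index), and the last
row is cleared by column operations. -/
noncomputable def dieudonneRep : (n : ℕ) → Matrix (Fin n) (Fin n) D → D
  | 0, _ => 1
  | n + 1, A =>
    if h : ∃ j, A (Fin.last n) j ≠ 0 then
      let j : Fin (n + 1) := (Finset.univ.filter fun j => A (Fin.last n) j ≠ 0).max'
        (by simpa [Finset.Nonempty] using h)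
      let B : Matrix (Fin (n + 1)) (Fin (n + 1)) D :=
        A.submatrix id (Equiv.swap j (Fin.last n))
      let b : D := B (Fin.last n) (Fin.last n)
      let d : D := dieudonneRep n (fun k l =>
        B k.castSucc l.castSucc - B k.castSucc (Fin.last n) * b⁻¹ * B (Fin.last n) l.castSucc) * b
      if j = Fin.last n then d else -d
    else 0

open Classical in
/-- The image of an element of `D` in `Dˣ / [Dˣ, Dˣ] ⊔ {0}`. -/
noncomputable def dieudonneClass (x : D) : WithZero (Abelianization Dˣ) :=
  if h : x = 0 then 0 else (Abelianization.of (Units.mk0 x h) : Abelianization Dˣ)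

/-- The Dieudonné determinant. -/
noncomputable def dieudonneDet {n : ℕ} (A : Matrix (Fin n) (Fin n) D) :
    WithZero (Abelianization Dˣ) :=
  dieudonneClass (dieudonneRep n A)

end Dieudonne

/-! ## Newton polytopes -/

namespace TwistedGroupRing

variable {R H : Type*} [DivisionRing R] [CommGroup H] {σ : StructureFunctions R H}

/-- The Newton polytope of a non-zero element: the convex hull of its support in `H₁(H; ℝ)`. -/
noncomputable def newtonPolytope (p : TwistedGroupRing σ) (hp : p ≠ 0) : IntegralPolytope H :=
  ⟨convexHull ℝ (latticePoint '' (p.support : Set H)), p.support,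
    Finsupp.support_nonempty_iff.2 fun h => hp (TwistedGroupRing.ext h), rfl⟩

variable [Group.FG H] [IsMulTorsionFree H]

/-- `P ∈ 𝒫(H)` is the Newton polytope `P(p) - P(q)` of the class of a fraction `p q⁻¹` in
`Dˣ / [Dˣ, Dˣ]`, where `D` is the Ore localisation of the twisted group ring. -/
def IsNewtonPolytope (d : WithZero (Abelianization (OreField σ)ˣ)) (P : PolytopeGroup H) : Prop :=
  ∃ (p q : TwistedGroupRing σ) (hp : p ≠ 0) (hq : q ≠ 0),
    d = dieudonneClass (toOreField σ p * (toOreField σ q)⁻¹) ∧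
    P = (newtonPolytope p hp).toGroup - (newtonPolytope q hq).toGroup

/-- `P ∈ 𝒫(H)` is the Newton polytope of the square matrix `A` over the twisted group ring, that is,
of the Dieudonné determinant of `A` over the Ore localisation. -/
def IsMatrixNewtonPolytope {n : ℕ} (A : Matrix (Fin n) (Fin n) (TwistedGroupRing σ))
    (P : PolytopeGroup H) : Prop :=
  IsNewtonPolytope (dieudonneDet (A.map (toOreField σ))) P

end TwistedGroupRing

/-! ## Agrarian groups -/

universe u v

/-- The integral group ring embeds into a skew field. -/
def IsAgrarian (G : Type u) [Group G] : Prop :=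
  ∃ (D : Type u) (_ : DivisionRing D) (j : MonoidAlgebra ℤ G →+* D), Function.Injective j

section Agrarian

variable (G : Type u) [Group G]

/-- The free part of the abelianisation of `G`. -/
abbrev FreeAb : Type u := Abelianization G ⧸ CommGroup.torsion (Abelianization G)

/-- The projection of `G` onto the free part of its abelianisation. -/
def toFreeAb : G →* FreeAb G := (QuotientGroup.mk' _).comp Abelianization.of

/-- A `G`-equivariant embedding of `ℤK` into a skew field, where `K` is the kernel of the
projection of `G` onto the free part of its abelianisation: `G` acts on the skew field by ring
automorphisms, this action extends the conjugation action of `G` on `ℤK`, and its restriction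
to `K` is conjugation by the elements of `K`. If `ℤG` embeds in a skew field, then restricting the
embedding to `ℤK` and letting `G` act by conjugation gives an example. -/
structure EquivariantEmbedding (𝕂 : Type v) [DivisionRing 𝕂] where
  emb : MonoidAlgebra ℤ (toFreeAb G).ker →+* 𝕂
  emb_injective : Function.Injective emb
  act : G →* RingAut 𝕂
  act_emb : ∀ (g : G) (k : (toFreeAb G).ker),
    act g (emb (MonoidAlgebra.of ℤ _ k)) = emb (MonoidAlgebra.of ℤ _ (MulAut.conjNormal g k))
  act_ker : ∀ (k : (toFreeAb G).ker) (a : 𝕂),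
    act k a = emb (MonoidAlgebra.of ℤ _ k) * a * (emb (MonoidAlgebra.of ℤ _ k))⁻¹

variable {G}

namespace EquivariantEmbedding

variable {𝕂 : Type v} [DivisionRing 𝕂] (E : EquivariantEmbedding G 𝕂)

/-- The element of `𝕂ˣ` given by an element of `K`. -/
noncomputable def unit : (toFreeAb G).ker →* 𝕂ˣ :=
  (E.emb.toMonoidHom.comp (MonoidAlgebra.of ℤ _)).toHomUnits

theorem coe_unit (k : (toFreeAb G).ker) :
    (E.unit k : 𝕂) = E.emb (MonoidAlgebra.of ℤ _ k) := rfl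

variable (s : FreeAb G → G) (hs : ∀ h, toFreeAb G (s h) = h)

/-- For a section `s` of `G → H`, the structure functions on `𝕂 H` are
`φ(h) = ` the action of `s(h)`, and `μ(h, h') = s(h) s(h') s(h h')⁻¹ ∈ K`. -/
noncomputable def structureFunctions : StructureFunctions 𝕂 (FreeAb G) where
  φ h := E.act (s h)
  μ h h' := E.unit ⟨s h * s h' * (s (h * h'))⁻¹, by simp [MonoidHom.mem_ker, hs]⟩
  φ_comp g g' r := by
    rw [← RingAut.mul_apply, ← map_mul, Units.val_inv_eq_inv_val, coe_unit, ← E.act_ker,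
      ← RingAut.mul_apply, ← map_mul]
    simp
  cocycle g g' g'' := by
    rw [coe_unit _ ⟨s g' * s g'' * (s (g' * g''))⁻¹, _⟩, E.act_emb, ← coe_unit,
      ← Units.val_mul, ← Units.val_mul, ← E.unit.map_mul, ← E.unit.map_mul]
    congr 2
    ext
    simp [mul_assoc]

/-- The twisted group ring `𝕂 H`. -/
abbrev Twisted : Type _ := TwistedGroupRing (E.structureFunctions s hs)

/-- The ring homomorphism `ℤG = (ℤK) H → 𝕂 H` sending `g ∈ G` with image `h ∈ H` to
`(g s(h)⁻¹) h`. -/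
noncomputable def groupRingHom : MonoidAlgebra ℤ G →+* E.Twisted s hs :=
  (MonoidAlgebra.lift ℤ (E.Twisted s hs) G
    { toFun := fun g => TwistedGroupRing.single _ (toFreeAb G g)
        (E.unit ⟨g * (s (toFreeAb G g))⁻¹, by simp [MonoidHom.mem_ker, hs]⟩)
      map_one' := by
        rw [TwistedGroupRing.one_def]
        refine congrArg₂ _ (map_one _) ?_
        simp only [structureFunctions, ← map_inv]
        congr 2
        ext
        simp
      map_mul' := fun g g' => by
        rw [TwistedGroupRing.single_mul_single]
        refine congrArg₂ _ (map_mul _ _ _) ?_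
        simp only [structureFunctions]
        rw [coe_unit _ ⟨g' * (s (toFreeAb G g'))⁻¹, _⟩, E.act_emb, ← coe_unit,
          ← Units.val_mul, ← Units.val_mul, ← E.unit.map_mul, ← E.unit.map_mul]
        congr 2
        ext
        simp [mul_assoc] }).toRingHom

end EquivariantEmbedding

end Agrarian

/-! ## The Whitehead group -/

section Whitehead

variable (R : Type*) [Ring R]

/-- Enlarging a square matrix by an identity matrix in the bottom-right corner. -/
def stabiliseMatrix {i j : ℕ} (hij : i ≤ j) :
    Matrix (Fin i) (Fin i) R →* Matrix (Fin j) (Fin j) R where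
  toFun A := Matrix.of fun a b =>
    if h : (a : ℕ) < i ∧ (b : ℕ) < i then A ⟨a, h.1⟩ ⟨b, h.2⟩ else if a = b then 1 else 0
  map_one' := by
    ext a b
    simp only [Matrix.of_apply, Matrix.one_apply, Fin.ext_iff]
    split_ifs <;> rfl
  map_mul' A B := by
    obtain ⟨k, rfl⟩ := Nat.exists_eq_add_of_le hij
    ext a b
    have h1 : ∀ (c : Fin i) (d : Fin k), (c : ℕ) ≠ i + d := fun c d => by omega
    have h2 : ∀ (c : Fin i) (d : Fin k), i + (d : ℕ) ≠ c := fun c d => by omega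
    rw [Matrix.mul_apply, Fin.sum_univ_add]
    induction a using Fin.addCases <;> induction b using Fin.addCases <;>
      simp [Matrix.mul_apply, Fin.ext_iff, h1, h2]
    simp [← Fin.ext_iff]

theorem stabiliseMatrix_apply {i j : ℕ} (hij : i ≤ j) (A : Matrix (Fin i) (Fin i) R)
    (a b : Fin j) : stabiliseMatrix R hij A a b =
      if h : (a : ℕ) < i ∧ (b : ℕ) < i then A ⟨a, h.1⟩ ⟨b, h.2⟩ else if a = b then 1 else 0 :=
  rfl

/-- The embedding `GL_i(R) → GL_j(R)` for `i ≤ j`. -/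
def stabilise (i j : ℕ) (hij : i ≤ j) : GL (Fin i) R →* GL (Fin j) R :=
  Units.map (stabiliseMatrix R hij)

instance : DirectedSystem (fun n => GL (Fin n) R) (stabilise R · · ·) where
  map_self i A := by
    ext a b
    simp [stabilise, stabiliseMatrix_apply]
  map_map k j i hij hjk A := by
    ext a b
    simp only [stabilise, Units.coe_map, stabiliseMatrix_apply, Fin.ext_iff]
    split_ifs <;> first | rfl | omega

/-- `GL(R)`, the directed union of the groups `GL_n(R)`. -/
abbrev StableGL : Type _ := DirectLimit (fun n => GL (Fin n) R) (stabilise R)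

variable {R} in
/-- The class of an invertible matrix in `GL(R)`. -/
noncomputable def StableGL.mk {n : ℕ} (A : GL (Fin n) R) : StableGL R := ⟦⟨n, A⟩⟧

/-- `K₁(R)`, the abelianisation of `GL(R)`. -/
abbrev K1 : Type _ := Abelianization (StableGL R)

variable {R} in
/-- The class of an invertible matrix in `K₁(R)`. -/
noncomputable def K1.mk {n : ℕ} (A : GL (Fin n) R) : K1 R := Abelianization.of (StableGL.mk A)

variable (G : Type u) [Group G]

/-- The subgroup of `K₁(ℤG)` generated by the `1 × 1` matrices `(± g)`. -/
noncomputable def trivialUnits : Subgroup (K1 (MonoidAlgebra ℤ G)) :=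
  Subgroup.closure {x | ∃ (u : (MonoidAlgebra ℤ G)ˣ) (g : G),
    ((u : MonoidAlgebra ℤ G) = MonoidAlgebra.of ℤ G g ∨
      (u : MonoidAlgebra ℤ G) = -MonoidAlgebra.of ℤ G g) ∧
    x = K1.mk (Matrix.GeneralLinearGroup.scalar (Fin 1) u)}

/-- The Whitehead group of `G`. -/
abbrev WhiteheadGroup : Type _ := K1 (MonoidAlgebra ℤ G) ⧸ trivialUnits G

variable {G} in
/-- The class of an invertible matrix over `ℤG` in the Whitehead group. -/
noncomputable def WhiteheadGroup.mk {n : ℕ} (A : GL (Fin n) (MonoidAlgebra ℤ G)) : WhiteheadGroup G :=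
  QuotientGroup.mk (K1.mk A)

end Whitehead

/-- `x ∈ 𝒫_T(H)` is the Newton polytope up to translation of the element `w` of the Whitehead
group: it is the class of the Newton polytope of some invertible matrix over `ℤG` representing
`w`. -/
def EquivariantEmbedding.IsWhiteheadNewtonPolytope {G : Type u} [Group G]
    [Group.FG (Abelianization G)] {𝕂 : Type v} [DivisionRing 𝕂] (E : EquivariantEmbedding G 𝕂)
    (s : FreeAb G → G) (hs : ∀ h, toFreeAb G (s h) = h)
    (w : WhiteheadGroup G) (x : PolytopeGroupT (FreeAb G)) : Prop :=
  ∃ (n : ℕ) (A : GL (Fin n) (MonoidAlgebra ℤ G)) (P : PolytopeGroup (FreeAb G)),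
    WhiteheadGroup.mk A = w ∧
    TwistedGroupRing.IsMatrixNewtonPolytope
      ((A : Matrix (Fin n) (Fin n) (MonoidAlgebra ℤ G)).map (E.groupRingHom s hs)) P ∧
    x = QuotientAddGroup.mk P

/-! ## Determinants with values in a commutative group with zero -/

section RowDet

open Matrix

variable {D : Type*} [DivisionRing D] {C : Type*} [CommGroupWithZero C] (w : D →*₀ C)

/-- The matrix obtained by deleting the `i`-th row and the last column. -/
def rowMinor {n : ℕ} (A : Fin (n + 1) → Fin (n + 1) → D) (i : Fin (n + 1)) :
    Fin n → Fin n → D := fun k j => A (i.succAbove k) j.castSucc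

open Classical in
/-- The composition of the Dieudonné determinant with a multiplicative map `w : D → C` with
`w (-1) = 1`, by expansion along a row `i` such that the last entry of the `i`-th column of the
inverse matrix is non-zero. -/
noncomputable def rowDet : (n : ℕ) → (Fin n → Fin n → D) → C
  | 0, _ => 1
  | n + 1, A =>
    if h : ∃ x : (Fin (n + 1) → D) × Fin (n + 1),
        ∑ m, x.1 m • A m = Pi.single (Fin.last n) 1 ∧ x.1 x.2 ≠ 0 then
      rowDet n (rowMinor A h.choose.2) * (w (h.choose.1 h.choose.2))⁻¹
    else 0

theorem LinearIndependent.exists_sum_smul_eq {n : ℕ} {A : Fin n → Fin n → D}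
    (hA : LinearIndependent D A) (v : Fin n → D) : ∃ c : Fin n → D, ∑ m, c m • A m = v := by
  have h := hA.span_eq_top_of_card_eq_finrank' (by simp)
  have h2 : v ∈ Submodule.span D (Set.range A) := h ▸ Submodule.mem_top
  exact (Submodule.mem_span_range_iff_exists_fun D).1 h2

theorem LinearIndependent.coeff_unique {ι V : Type*} [Fintype ι] [AddCommGroup V] [Module D V]
    {A : ι → V} (hA : LinearIndependent D A) {c d : ι → D}
    (h : ∑ m, c m • A m = ∑ m, d m • A m) : c = d := by
  have := Fintype.linearIndependent_iff.1 hA (fun m => c m - d m) (by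
    simp [sub_smul, Finset.sum_sub_distrib, h])
  exact funext fun m => sub_eq_zero.1 (this m)

theorem sum_smul_update {ι V : Type*} [Fintype ι] [DecidableEq ι] [AddCommGroup V] [Module D V]
    (A : ι → V) (i : ι) (g c : ι → D) :
    ∑ m, g m • Function.update A i (∑ k, c k • A k) m =
      ∑ m, ((if m = i then 0 else g m) + g i * c m) • A m := by
  have h : ∀ m, g m • Function.update A i (∑ k, c k • A k) m =
      (if m = i then 0 else g m) • A m + if m = i then g i • ∑ k, c k • A k else 0 := by
    intro m
    by_cases hm : m = i
    · subst hm; simp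
    · simp [hm]
  simp only [h, Finset.sum_add_distrib, add_smul, Finset.sum_ite_eq', Finset.mem_univ, if_true,
    Finset.smul_sum, mul_smul]

theorem LinearIndependent.update_sum {ι V : Type*} [Fintype ι] [DecidableEq ι] [AddCommGroup V]
    [Module D V] {A : ι → V} (hA : LinearIndependent D A) {i : ι} {c : ι → D} (hc : c i ≠ 0) :
    LinearIndependent D (Function.update A i (∑ m, c m • A m)) := by
  rw [Fintype.linearIndependent_iff]
  intro g hg
  rw [sum_smul_update] at hg
  have h := Fintype.linearIndependent_iff.1 hA _ hg
  have hi : g i = 0 := by simpa [hc] using h i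
  intro m
  by_cases hm : m = i
  · rw [hm, hi]
  · simpa [hm, hi] using h m

theorem sum_succAbove_truncate {n : ℕ} {A : Fin (n + 1) → Fin (n + 1) → D} {l : Fin (n + 1) → D}
    {x : D} (hl : ∑ m, l m • A m = Pi.single (Fin.last n) x) (i : Fin (n + 1)) (j : Fin n) :
    l i * A i j.castSucc + ∑ m, l (i.succAbove m) * rowMinor A i m j = 0 := by
  have h := congrFun hl j.castSucc
  rw [Finset.sum_apply, Fin.sum_univ_succAbove _ i, Pi.single_eq_of_ne (by simp)] at h
  simpa [rowMinor] using h

theorem LinearIndependent.rowMinor {n : ℕ} {A : Fin (n + 1) → Fin (n + 1) → D}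
    (hA : LinearIndependent D A) {l : Fin (n + 1) → D}
    (hl : ∑ m, l m • A m = Pi.single (Fin.last n) 1) {i : Fin (n + 1)} (hi : l i ≠ 0) :
    LinearIndependent D (rowMinor A i) := by
  rw [Fintype.linearIndependent_iff]
  intro g hg
  let d : D := ∑ m, g m * A (i.succAbove m) (Fin.last n)
  let g' : Fin (n + 1) → D := i.insertNth 0 g
  have h1 : ∑ m, g' m • A m = ∑ m, (d * l m) • A m := by
    simp only [mul_smul]
    rw [← Finset.smul_sum, hl]
    ext j
    rw [Finset.sum_apply, Fin.sum_univ_succAbove _ i]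
    induction j using Fin.lastCases with
    | last => simp [g', d]
    | cast j =>
      have := congrFun hg j
      simp only [Finset.sum_apply, Pi.smul_apply, smul_eq_mul, Pi.zero_apply] at this
      simpa [g', _root_.rowMinor] using this
  have h2 := hA.coeff_unique h1
  have h3 : d = 0 := by
    have := congrFun h2 i
    simpa [g', hi] using this.symm
  intro m
  have := congrFun h2 (i.succAbove m)
  simpa [g', h3] using this

variable {w}

section RowLaw

variable {n : ℕ} (law : ∀ A : Fin n → Fin n → D, LinearIndependent D A → ∀ (i : Fin n)
    (c : Fin n → D), c i ≠ 0 →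
      rowDet w n (Function.update A i (∑ m, c m • A m)) = w (c i) * rowDet w n A)
  (hw : w (-1) = 1)

include law

theorem rowDet_update_add_of_law {A : Fin n → Fin n → D} (hA : LinearIndependent D A)
    {i j : Fin n} (hij : i ≠ j) (r : D) :
    rowDet w n (Function.update A i (A i + r • A j)) = rowDet w n A ∧
      LinearIndependent D (Function.update A i (A i + r • A j)) := by
  have h : A i + r • A j = ∑ m, (Pi.single i 1 + Pi.single j r : Fin n → D) m • A m := by
    simp [add_smul, Finset.sum_add_distrib, Pi.single_apply, ite_smul]
  have hc : (Pi.single i 1 + Pi.single j r : Fin n → D) i = 1 := by simp [hij]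
  rw [h, law A hA i _ (by rw [hc]; exact one_ne_zero), hc]
  exact ⟨by simp, hA.update_sum (by rw [hc]; exact one_ne_zero)⟩

theorem rowDet_update_smul_of_law {A : Fin n → Fin n → D} (hA : LinearIndependent D A)
    (i : Fin n) {r : D} (hr : r ≠ 0) :
    rowDet w n (Function.update A i (r • A i)) = w r * rowDet w n A ∧
      LinearIndependent D (Function.update A i (r • A i)) := by
  have h : r • A i = ∑ m, (Pi.single i r : Fin n → D) m • A m := by
    simp [Pi.single_apply, ite_smul]
  have hc : (Pi.single i r : Fin n → D) i = r := by simp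
  rw [h, law A hA i _ (by rwa [hc]), hc]
  exact ⟨rfl, hA.update_sum (by rwa [hc])⟩

include hw

theorem rowDet_comp_swap_of_law {A : Fin n → Fin n → D} (hA : LinearIndependent D A)
    {i j : Fin n} (hij : i ≠ j) : rowDet w n (A ∘ Equiv.swap i j) = rowDet w n A := by
  obtain ⟨e1, l1⟩ := rowDet_update_add_of_law law hA hij 1
  obtain ⟨e2, l2⟩ := rowDet_update_add_of_law law l1 hij.symm (-1)
  obtain ⟨e3, l3⟩ := rowDet_update_add_of_law law l2 hij 1
  obtain ⟨e4, -⟩ := rowDet_update_smul_of_law law l3 j (neg_ne_zero.2 (one_ne_zero (α := D)))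
  rw [e3, e2, e1, hw, one_mul] at e4
  rw [← e4]
  congr 1
  ext m k
  by_cases hmi : m = i
  · subst hmi; simp [hij, hij.symm]
  · by_cases hmj : m = j
    · subst hmj; simp [hij, hij.symm]
    · simp [hmi, hmj, Equiv.swap_apply_of_ne_of_ne]

theorem rowDet_comp_perm_of_law {A : Fin n → Fin n → D} (hA : LinearIndependent D A)
    (τ : Equiv.Perm (Fin n)) : rowDet w n (A ∘ τ) = rowDet w n A := by
  induction τ using Equiv.Perm.swap_induction_on' with
  | one => rfl
  | mul_swap τ i j hij ih =>
    rw [← ih]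
    exact rowDet_comp_swap_of_law law hw (hA.comp τ τ.injective) hij

theorem rowMinor_compare_of_law {A : Fin (n + 1) → Fin (n + 1) → D} (hA : LinearIndependent D A)
    {l : Fin (n + 1) → D} (hl : ∑ m, l m • A m = Pi.single (Fin.last n) 1)
    {i k : Fin (n + 1)} (hi : l i ≠ 0) (hk : l k ≠ 0) :
    rowDet w n (rowMinor A i) * (w (l i))⁻¹ = rowDet w n (rowMinor A k) * (w (l k))⁻¹ := by
  by_cases hik : i = k
  · rw [hik]
  obtain ⟨m₀, hm₀⟩ := Fin.exists_succAbove_eq (Ne.symm hik)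
  have hne : ∀ m, Equiv.swap i k (i.succAbove m) ≠ k := fun m h => by
    rw [Equiv.swap_apply_eq_iff, Equiv.swap_apply_right] at h
    exact Fin.succAbove_ne i m h
  choose t ht using fun m => Fin.exists_succAbove_eq (hne m)
  have htinj : Function.Injective t := fun a b hab => by
    have := ht a
    rw [hab, ht b] at this
    exact (Fin.succAbove_right_injective ((Equiv.swap i k).injective this)).symm
  let τ : Equiv.Perm (Fin n) := Equiv.ofBijective t (Finite.injective_iff_bijective.1 htinj)
  let c : Fin n → D := fun m => -(l i)⁻¹ * l (i.succAbove m)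
  have hc : c m₀ = -1 * ((l i)⁻¹ * l k) := by simp [c, hm₀]
  have hc0 : c m₀ ≠ 0 := by simp [hc, hi, hk]
  have h1 : rowMinor A k ∘ τ = Function.update (rowMinor A i) m₀ (∑ m, c m • rowMinor A i m) := by
    ext m j
    by_cases hm : m = m₀
    · subst hm
      have h2 := sum_succAbove_truncate hl i j
      rw [add_comm, add_eq_zero_iff_eq_neg] at h2
      have h3 : k.succAbove (t m) = i := by rw [ht, hm₀, Equiv.swap_apply_right]
      simp only [Function.comp_apply, Function.update_self, Finset.sum_apply, Pi.smul_apply,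
        smul_eq_mul, c, mul_assoc]
      rw [← Finset.mul_sum, h2]
      simp [rowMinor, τ, h3, hi]
    · have h3 : k.succAbove (t m) = i.succAbove m := by
        rw [ht, Equiv.swap_apply_of_ne_of_ne (Fin.succAbove_ne i m)]
        rw [← hm₀]
        exact fun h => hm (Fin.succAbove_right_injective h)
      simp [rowMinor, τ, h3, hm]
  rw [← rowDet_comp_perm_of_law law hw (hA.rowMinor hl hk) τ, h1,
    law _ (hA.rowMinor hl hi) m₀ c hc0, hc, map_mul, hw, map_mul, map_inv₀]
  have hi' : w (l i) ≠ 0 := (map_ne_zero w).2 hi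
  have hk' : w (l k) ≠ 0 := (map_ne_zero w).2 hk
  field_simp

theorem rowDet_succ_of_law {A : Fin (n + 1) → Fin (n + 1) → D} (hA : LinearIndependent D A)
    {l : Fin (n + 1) → D} (hl : ∑ m, l m • A m = Pi.single (Fin.last n) 1)
    {i : Fin (n + 1)} (hi : l i ≠ 0) :
    rowDet w (n + 1) A = rowDet w n (rowMinor A i) * (w (l i))⁻¹ := by
  have h : ∃ x : (Fin (n + 1) → D) × Fin (n + 1),
      ∑ m, x.1 m • A m = Pi.single (Fin.last n) 1 ∧ x.1 x.2 ≠ 0 := ⟨(l, i), hl, hi⟩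
  rw [rowDet, dif_pos h]
  have h2 : h.choose.1 = l := hA.coeff_unique (h.choose_spec.1.trans hl.symm)
  have h3 := h.choose_spec.2
  rw [h2] at h3 ⊢
  exact rowMinor_compare_of_law law hw hA hl h3 hi

end RowLaw

variable (hw : w (-1) = 1)

include hw

theorem rowDet_update {n : ℕ} {A : Fin n → Fin n → D} (hA : LinearIndependent D A) (i : Fin n)
    (c : Fin n → D) (hc : c i ≠ 0) :
    rowDet w n (Function.update A i (∑ m, c m • A m)) = w (c i) * rowDet w n A := by
  induction n with
  | zero => exact i.elim0
  | succ n ih =>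
  have law := fun A hA i c hc => ih (A := A) hA i c hc
  obtain ⟨l, hl⟩ := hA.exists_sum_smul_eq (Pi.single (Fin.last n) 1)
  set A' := Function.update A i (∑ m, c m • A m) with hA'
  have hLA' : LinearIndependent D A' := hA.update_sum hc
  by_cases hi : l i = 0
  · obtain ⟨k, hk⟩ : ∃ k, l k ≠ 0 := by
      by_contra! h
      have := congrFun hl (Fin.last n)
      simp [h] at this
    have hik : i ≠ k := fun h => hk (h ▸ hi)
    have hl' : ∑ m, l m • A' m = Pi.single (Fin.last n) 1 := by
      rw [← hl]
      refine Finset.sum_congr rfl fun m _ => ?_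
      by_cases hm : m = i
      · rw [hm, hi, zero_smul, zero_smul]
      · rw [hA', Function.update_of_ne hm]
    rw [rowDet_succ_of_law law hw hLA' hl' hk, rowDet_succ_of_law law hw hA hl hk]
    obtain ⟨m₀, hm₀⟩ := Fin.exists_succAbove_eq hik
    let d : Fin n → D := fun m => c (k.succAbove m) - c k * (l k)⁻¹ * l (k.succAbove m)
    have hd : d m₀ = c i := by simp [d, hm₀, hi]
    have h1 : rowMinor A' k =
        Function.update (rowMinor A k) m₀ (∑ m, d m • rowMinor A k m) := by
      ext m j
      by_cases hm : m = m₀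
      · subst hm
        have h2 := sum_succAbove_truncate hl k j
        rw [add_comm, add_eq_zero_iff_eq_neg] at h2
        have h3 : ∑ m, d m * rowMinor A k m j = ∑ m, c m * A m j.castSucc := by
          simp only [d, sub_mul, Finset.sum_sub_distrib, mul_assoc]
          rw [← Finset.mul_sum, ← Finset.mul_sum, h2, Fin.sum_univ_succAbove _ k]
          simp [hk, rowMinor, add_comm]
        rw [Function.update_self, Finset.sum_apply]
        simp only [Pi.smul_apply, smul_eq_mul, h3]
        simp [rowMinor, hA', hm₀]
      · have h3 : k.succAbove m ≠ i := fun h =>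
          hm (Fin.succAbove_right_injective (h.trans hm₀.symm))
        simp [rowMinor, hA', h3, hm]
    rw [h1, law _ (hA.rowMinor hl hk) m₀ d (by rwa [hd]), hd, mul_assoc]
  · let l' : Fin (n + 1) → D := fun m => if m = i then l i * (c i)⁻¹ else l m - l i * (c i)⁻¹ * c m
    have hl'i : l' i = l i * (c i)⁻¹ := by simp [l']
    have hl' : ∑ m, l' m • A' m = Pi.single (Fin.last n) 1 := by
      rw [← hl, hA', sum_smul_update]
      refine Finset.sum_congr rfl fun m _ => ?_
      congr 1
      by_cases hm : m = i
      · subst hm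
        simp [l', hc, mul_assoc]
      · simp [l', hm]
    have hl'0 : l' i ≠ 0 := by simp [hl'i, hi, hc]
    rw [rowDet_succ_of_law law hw hLA' hl' hl'0, rowDet_succ_of_law law hw hA hl hi]
    have h1 : rowMinor A' i = rowMinor A i := by
      ext m j
      simp [rowMinor, hA', Fin.succAbove_ne]
    rw [h1, hl'i, map_mul, map_inv₀, mul_inv, inv_inv]
    ac_rfl

theorem rowDet_comp_perm {n : ℕ} {A : Fin n → Fin n → D} (hA : LinearIndependent D A)
    (τ : Equiv.Perm (Fin n)) : rowDet w n (A ∘ τ) = rowDet w n A :=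
  rowDet_comp_perm_of_law (fun _ h => rowDet_update hw h) hw hA τ

theorem rowDet_succ {n : ℕ} {A : Fin (n + 1) → Fin (n + 1) → D} (hA : LinearIndependent D A)
    {l : Fin (n + 1) → D} (hl : ∑ m, l m • A m = Pi.single (Fin.last n) 1)
    {i : Fin (n + 1)} (hi : l i ≠ 0) :
    rowDet w (n + 1) A = rowDet w n (rowMinor A i) * (w (l i))⁻¹ :=
  rowDet_succ_of_law (fun _ h => rowDet_update hw h) hw hA hl hi

end RowDet

section RowDetMul

open Matrix

variable {D : Type*} [DivisionRing D] {C : Type*} [CommGroupWithZero C] {w : D →*₀ C}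

/-- Every basis is obtained from every other one by successively replacing one vector. -/
theorem LinearIndependent.update_induction {n : ℕ} {P : (Fin n → Fin n → D) → Prop}
    (step : ∀ X, LinearIndependent D X → P X → ∀ (i : Fin n) (c : Fin n → D), c i ≠ 0 →
      P (Function.update X i (∑ m, c m • X m)))
    {A B : Fin n → Fin n → D} (hB : LinearIndependent D B) (hP : P B)
    (hA : LinearIndependent D A) : P A := by
  classical
  suffices h : ∀ (k : ℕ) (X : Fin n → Fin n → D), LinearIndependent D X → P X →
      (Finset.univ.filter fun i => X i ≠ A i).card = k → P A from h _ B hB hP rfl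
  intro k
  induction k using Nat.strong_induction_on with
  | _ k ih =>
  intro X hX hPX hk
  by_cases hXA : X = A
  · exact hXA ▸ hPX
  obtain ⟨i, hi⟩ := Function.ne_iff.1 hXA
  have close : ∀ Y : Fin n → Fin n → D, LinearIndependent D Y → P Y →
      (∀ m, X m = A m → Y m = A m) → ∀ c : Fin n → D, ∑ m, c m • Y m = A i → c i ≠ 0 → P A := by
    intro Y hY hPY hYA c hc hci
    refine ih _ ?_ _ (hY.update_sum hci) (step Y hY hPY i c hci) rfl
    rw [← hk, hc]
    refine Finset.card_lt_card ((Finset.ssubset_iff_of_subset fun m hm => ?_).2 ⟨i, ?_, ?_⟩)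
    · rw [Finset.mem_filter] at hm ⊢
      refine ⟨hm.1, fun h => hm.2 ?_⟩
      by_cases hmi : m = i
      · rw [hmi, Function.update_self]
      · rw [Function.update_of_ne hmi, hYA m h]
    · simpa using hi
    · simp
  obtain ⟨c, hc⟩ := hX.exists_sum_smul_eq (A i)
  by_cases hci : c i = 0
  · obtain ⟨j, hj, hjA⟩ : ∃ j, c j ≠ 0 ∧ X j ≠ A j := by
      by_contra! h
      have h1 : ∑ m, c m • A m = ∑ m, (Pi.single i 1 : Fin n → D) m • A m := by
        have h2 : ∑ m, c m • A m = ∑ m, c m • X m := by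
          refine Finset.sum_congr rfl fun m _ => ?_
          by_cases hm : c m = 0
          · rw [hm, zero_smul, zero_smul]
          · rw [h m hm]
        rw [h2, hc]
        simp [Pi.single_apply, ite_smul]
      have h3 := congrFun (hA.coeff_unique h1) i
      simp [hci] at h3
    have hij : i ≠ j := fun h => hj (h ▸ hci)
    let e : Fin n → D := Pi.single j 1 + Pi.single i 1
    have hej : e j = 1 := by simp [e, hij]
    have he : ∑ m, e m • X m = X j + X i := by
      simp [e, add_smul, Finset.sum_add_distrib, Pi.single_apply, ite_smul]
    have hej0 : e j ≠ 0 := by rw [hej]; exact one_ne_zero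
    refine close (Function.update X j (∑ m, e m • X m)) (hX.update_sum hej0)
      (step X hX hPX j e hej0) (fun m hm => ?_) (c - Pi.single i (c j)) ?_ ?_
    · rw [Function.update_of_ne, hm]
      rintro rfl
      exact hjA hm
    · rw [← hc, sum_smul_update]
      refine Finset.sum_congr rfl fun m _ => ?_
      congr 1
      by_cases hmj : m = j
      · subst hmj
        simp [e, hij]
      · by_cases hmi : m = i
        · subst hmi
          simp [e, hij, hij.symm]
        · simp [e, hmj, hmi, hij.symm]
    · simpa [hci] using hj
  · exact close X hX hPX (fun _ h => h) c hc hci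

theorem LinearIndependent.vecMul {n : ℕ} {A B : Fin n → Fin n → D} (hA : LinearIndependent D A)
    (hB : LinearIndependent D B) : LinearIndependent D (fun i => A i ᵥ* of B) := by
  rw [Fintype.linearIndependent_iff]
  intro g hg
  have h1 : ∑ m, (∑ i, g i • A i) m • B m = 0 := by
    rw [← hg]
    simp only [vecMul_eq_sum, Finset.smul_sum, Finset.sum_apply, Finset.sum_smul, Pi.smul_apply,
      smul_eq_mul, mul_smul]
    rw [Finset.sum_comm]
    rfl
  have h2 := Fintype.linearIndependent_iff.1 hB _ h1
  exact Fintype.linearIndependent_iff.1 hA _ (funext h2)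

theorem linearIndependent_single (n : ℕ) :
    LinearIndependent D (fun i : Fin n => (Pi.single i 1 : Fin n → D)) :=
  Pi.linearIndependent_single_one (Fin n) D

theorem LinearIndependent.of_mul_eq_one {n : ℕ} {A B : Matrix (Fin n) (Fin n) D}
    (h : A * B = 1) : LinearIndependent D (fun i => A i) := by
  rw [Fintype.linearIndependent_iff]
  intro g hg
  have h1 : g ᵥ* A = 0 := by rw [vecMul_eq_sum]; exact hg
  have h2 : g ᵥ* (A * B) = 0 := by rw [← vecMul_vecMul, h1, zero_vecMul]
  rw [h, vecMul_one] at h2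
  exact congrFun h2

variable (hw : w (-1) = 1)

include hw

theorem rowDet_single (n : ℕ) : rowDet w n (fun i => Pi.single i 1) = 1 := by
  induction n with
  | zero => rfl
  | succ n ih =>
    rw [rowDet_succ hw (linearIndependent_single _) (l := Pi.single (Fin.last n) 1)
      (i := Fin.last n) (by simp [Pi.single_apply, ite_smul]) (by simp)]
    have : rowMinor (fun i : Fin (n + 1) => (Pi.single i 1 : Fin (n + 1) → D)) (Fin.last n) =
        fun i => Pi.single i 1 := by
      ext i j
      simp [rowMinor, Pi.single_apply]
    rw [this, ih]
    simp

theorem rowDet_vecMul {n : ℕ} {A B : Fin n → Fin n → D} (hA : LinearIndependent D A)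
    (hB : LinearIndependent D B) :
    rowDet w n (fun i => A i ᵥ* of B) = rowDet w n A * rowDet w n B := by
  refine LinearIndependent.update_induction
    (P := fun A => rowDet w n (fun i => A i ᵥ* of B) = rowDet w n A * rowDet w n B)
    (fun X hX ih i c hc => ?_) (linearIndependent_single n) ?_ hA
  · have h : (fun k => Function.update X i (∑ m, c m • X m) k ᵥ* of B) =
        Function.update (fun k => X k ᵥ* of B) i (∑ m, c m • X m ᵥ* of B) := by
      funext k
      by_cases hk : k = i
      · subst hk
        simp [sum_vecMul, smul_vecMul]
      · simp [hk]
    rw [h, rowDet_update hw (hX.vecMul hB) i c hc, rowDet_update hw hX i c hc, ih, mul_assoc]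
  · rw [rowDet_single hw, one_mul]
    congr 1
    funext i
    simp

theorem rowDet_mul {n : ℕ} {A B : Matrix (Fin n) (Fin n) D} (hA : LinearIndependent D A)
    (hB : LinearIndependent D B) : rowDet w n (A * B) = rowDet w n A * rowDet w n B :=
  rowDet_vecMul hw hA hB

theorem rowDet_comp_perm_right {n : ℕ} {A : Fin n → Fin n → D} (hA : LinearIndependent D A)
    (τ : Equiv.Perm (Fin n)) : rowDet w n (fun i j => A i (τ j)) = rowDet w n A ∧
      LinearIndependent D (fun i j => A i (τ j)) := by
  have hB : LinearIndependent D
      ((fun i : Fin n => (Pi.single i 1 : Fin n → D)) ∘ (τ⁻¹ : Equiv.Perm (Fin n))) :=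
    (linearIndependent_single n).comp _ (τ⁻¹).injective
  have h : (fun i => A i ᵥ* of
      ((fun i : Fin n => (Pi.single i 1 : Fin n → D)) ∘ (τ⁻¹ : Equiv.Perm (Fin n)))) =
      fun i j => A i (τ j) := by
    ext i j
    simp only [vecMul_eq_sum, Finset.sum_apply, Pi.smul_apply, of_apply, Function.comp_apply,
      smul_eq_mul]
    rw [Finset.sum_eq_single (τ j)]
    · simp
    · intro m _ hm
      rw [Pi.single_eq_of_ne, mul_zero]
      rintro rfl
      simp at hm
    · simp
  rw [← h]
  refine ⟨?_, hA.vecMul hB⟩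
  rw [rowDet_vecMul hw hA hB, rowDet_comp_perm hw (linearIndependent_single n),
    rowDet_single hw, mul_one]

theorem rowDet_add_smul {n : ℕ} {A : Fin n → Fin n → D} (hA : LinearIndependent D A) (j : Fin n)
    (c : Fin n → D) {s : Finset (Fin n)} (hs : j ∉ s) :
    rowDet w n (fun k => if k ∈ s then A k + c k • A j else A k) = rowDet w n A ∧
      LinearIndependent D (fun k => if k ∈ s then A k + c k • A j else A k) := by
  induction s using Finset.induction_on with
  | empty => simpa using hA
  | insert a s ha ih =>
    rw [Finset.mem_insert, not_or] at hs
    obtain ⟨ih1, ih2⟩ := ih hs.2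
    have h := rowDet_update_add_of_law (fun _ h => rowDet_update hw h) ih2 (Ne.symm hs.1) (c a)
    have h1 : (fun k => if k ∈ insert a s then A k + c k • A j else A k) =
        Function.update (fun k => if k ∈ s then A k + c k • A j else A k) a
          ((fun k => if k ∈ s then A k + c k • A j else A k) a + c a •
            (fun k => if k ∈ s then A k + c k • A j else A k) j) := by
      funext k
      by_cases hk : k = a
      · subst hk
        simp [ha, hs.2]
      · simp [hk]
    rw [h1, ← ih1]
    exact h

open Classical in
theorem rowDet_eq_map_dieudonneRep {n : ℕ} {A : Matrix (Fin n) (Fin n) D}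
    (hA : LinearIndependent D A) : rowDet w n A = w (dieudonneRep n A) := by
  induction n with
  | zero => simp [rowDet, dieudonneRep]
  | succ n ih =>
    have h : ∃ j, A (Fin.last n) j ≠ 0 := Function.ne_iff.1 (hA.ne_zero (Fin.last n))
    rw [dieudonneRep, dif_pos h]
    extract_lets j B b d
    have hj : A (Fin.last n) j ≠ 0 := (Finset.mem_filter (s := Finset.univ)
      (p := fun j => A (Fin.last n) j ≠ 0) (a := j)).1 (Finset.max'_mem _ _) |>.2
    have hb : b ≠ 0 := by simpa [b, B] using hj
    have hd : w (if j = Fin.last n then d else -d) = w d := by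
      split_ifs
      · rfl
      · rw [← neg_one_mul, map_mul, hw, one_mul]
    obtain ⟨e1, l1⟩ := rowDet_comp_perm_right hw hA (Equiv.swap j (Fin.last n))
    obtain ⟨e2, l2⟩ := rowDet_add_smul hw l1 (Fin.last n) (fun k => -(B k (Fin.last n) * b⁻¹))
      (s := Finset.univ.erase (Fin.last n)) (by simp)
    rw [hd, ← e1, ← e2]
    set B' : Fin (n + 1) → Fin (n + 1) → D := _
    change LinearIndependent D B' at l2
    obtain ⟨l, hl⟩ := l2.exists_sum_smul_eq (Pi.single (Fin.last n) 1)
    have hB1 : ∀ k : Fin n, ∀ m, B' k.castSucc m = B k.castSucc m -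
        B k.castSucc (Fin.last n) * b⁻¹ * B (Fin.last n) m := fun k m => by
      have : B' k.castSucc m = B k.castSucc m +
        -(B k.castSucc (Fin.last n) * b⁻¹) * B (Fin.last n) m := by
          simp [B', B]
      rw [this, neg_mul, sub_eq_add_neg]
    have hB2 : ∀ m, B' (Fin.last n) m = B (Fin.last n) m := fun m => by simp [B', B]
    have h1 : l (Fin.last n) * b = 1 := by
      have h2 := congrFun hl (Fin.last n)
      rw [Finset.sum_apply, Fin.sum_univ_castSucc] at h2
      simp only [Pi.smul_apply, smul_eq_mul, hB1, hB2, Pi.single_eq_same, mul_assoc] at h2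
      simpa [b, inv_mul_cancel₀ hb] using h2
    have h3 : l (Fin.last n) = b⁻¹ := eq_inv_of_mul_eq_one_left h1
    have h4 : l (Fin.last n) ≠ 0 := by rw [h3]; exact inv_ne_zero hb
    rw [rowDet_succ hw l2 hl h4, h3, map_inv₀, inv_inv, map_mul]
    congr 1
    have h5 := ih (l2.rowMinor hl h4)
    rw [h5]
    congr 2
    ext k m
    simp [rowMinor, hB1]

end RowDetMul

/-! ## Valuations on twisted group rings -/

namespace TwistedGroupRing

section Homogeneous

variable {R H M : Type*} [DivisionRing R] [CommGroup H] [CommGroup M] {σ : StructureFunctions R H}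
  (π : H →* M)

/-- The support lies in a fibre of `π`. -/
def IsHomogeneous (γ : M) (x : TwistedGroupRing σ) : Prop := ∀ h ∈ x.support, π h = γ

open Classical in
/-- The part of `x` supported in a fibre of `π`. -/
noncomputable def component (γ : M) (x : TwistedGroupRing σ) : TwistedGroupRing σ :=
  ⟨x.coeff.filter fun h => π h = γ⟩

variable {π}

theorem mem_support {x : TwistedGroupRing σ} {h : H} : h ∈ x.support ↔ x.coeff h ≠ 0 :=
  Finsupp.mem_support_iff

theorem support_nonempty {x : TwistedGroupRing σ} (hx : x ≠ 0) : x.support.Nonempty :=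
  Finsupp.support_nonempty_iff.2 fun h => hx (TwistedGroupRing.ext h)

theorem support_single {h : H} {r : R} (hr : r ≠ 0) : (single σ h r).support = {h} :=
  Finsupp.support_single _ hr

theorem single_ne_zero {h : H} {r : R} (hr : r ≠ 0) : single σ h r ≠ 0 := fun e => by
  have := congrArg (fun x => x.coeff h) e
  simp [hr] at this

theorem isHomogeneous_single (h : H) (r : R) : IsHomogeneous π (π h) (single σ h r) := by
  intro g hg
  rw [mem_support, coeff_single, Finsupp.single_apply_ne_zero] at hg
  rw [hg.1]

theorem isHomogeneous_component (γ : M) (x : TwistedGroupRing σ) :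
    IsHomogeneous π γ (component π γ x) := by
  classical
  intro h hh
  rw [mem_support] at hh
  by_contra hne
  exact hh (Finsupp.filter_apply_neg _ _ hne)

theorem component_add (γ : M) (x y : TwistedGroupRing σ) :
    component π γ (x + y) = component π γ x + component π γ y := by
  classical
  ext1
  exact Finsupp.filter_add

theorem component_zero (γ : M) : component π γ (0 : TwistedGroupRing σ) = 0 := by
  classical
  ext1
  exact Finsupp.filter_zero _

theorem IsHomogeneous.component_self {γ : M} {x : TwistedGroupRing σ} (hx : IsHomogeneous π γ x) :
    component π γ x = x := by
  classical
  ext1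
  exact Finsupp.filter_eq_self_iff _ _ |>.2 fun h hh => hx h (mem_support.2 hh)

theorem IsHomogeneous.component_of_ne {γ δ : M} {x : TwistedGroupRing σ}
    (hx : IsHomogeneous π γ x) (h : γ ≠ δ) : component π δ x = 0 := by
  classical
  ext1
  refine Finsupp.filter_eq_zero_iff _ _ |>.2 fun g hg => ?_
  by_contra hne
  exact h ((hx g (mem_support.2 hne)).symm.trans hg)

theorem IsHomogeneous.mul {γ δ : M} {x y : TwistedGroupRing σ} (hx : IsHomogeneous π γ x)
    (hy : IsHomogeneous π δ y) : IsHomogeneous π (γ * δ) (x * y) := by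
  classical
  intro h hh
  obtain ⟨a, ha, b, hb, rfl⟩ := Finset.mem_mul.1 (support_mul_subset x y hh)
  rw [map_mul, hx a ha, hy b hb]

theorem IsHomogeneous.component_mul {δ : M} {y : TwistedGroupRing σ} (hy : IsHomogeneous π δ y)
    (γ : M) (x : TwistedGroupRing σ) : component π (γ * δ) (x * y) = component π γ x * y := by
  induction x using TwistedGroupRing.induction with
  | h0 => simp only [zero_mul, component_zero]
  | hadd x x' hx hx' => rw [add_mul, component_add, component_add, hx, hx', add_mul]
  | hs g r =>
    have h1 := (isHomogeneous_single (σ := σ) (π := π) g r).mul hy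
    by_cases hg : π g = γ
    · subst hg
      rw [h1.component_self, (isHomogeneous_single g r).component_self]
    · rw [h1.component_of_ne fun h => hg (mul_right_cancel h),
        (isHomogeneous_single g r).component_of_ne hg, zero_mul]

/-- The Ore condition for homogeneous elements. -/
theorem exists_homogeneous_ore [Group.FG H] [IsMulTorsionFree H] {α β : M}
    {a b : TwistedGroupRing σ} (ha : IsHomogeneous π α a) (hb : IsHomogeneous π β b)
    (hb0 : b ≠ 0) : ∃ q p : TwistedGroupRing σ, q ≠ 0 ∧ IsHomogeneous π 1 q ∧
      IsHomogeneous π (α * β⁻¹) p ∧ q * a = p * b := by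
  obtain ⟨r, s, hs, h⟩ := exists_ore σ a b hb0
  obtain ⟨g, hg⟩ := support_nonempty hs
  have h1 := congrArg (component π (π g * α)) h
  rw [ha.component_mul] at h1
  have h2 : π g * α = π g * α * β⁻¹ * β := by simp
  rw [h2, hb.component_mul] at h1
  have hc : component π (π g) s ≠ 0 := fun e => by
    classical
    have e2 := congrArg (fun x => x.coeff g) e
    have e3 : (component π (π g) s).coeff g = s.coeff g := Finsupp.filter_apply_pos _ _ rfl
    exact mem_support.1 hg (e3.symm.trans e2)
  have hu : IsHomogeneous π (π g)⁻¹ (single σ g⁻¹ 1) := by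
    rw [← map_inv]; exact isHomogeneous_single _ _
  refine ⟨single σ g⁻¹ 1 * component π (π g) s, single σ g⁻¹ 1 * component π (π g * α * β⁻¹) r,
    mul_ne_zero (single_ne_zero one_ne_zero) hc, ?_, ?_, ?_⟩
  · simpa using hu.mul (isHomogeneous_component (π g) s)
  · have := hu.mul (isHomogeneous_component (π g * α * β⁻¹) r)
    rwa [← mul_assoc (π g)⁻¹, ← mul_assoc (π g)⁻¹, inv_mul_cancel, one_mul] at this
  · rw [mul_assoc, mul_assoc, h1]

end Homogeneous

section Valuation

variable {R H Λ : Type*} [DivisionRing R] [CommGroup H] [CommGroup Λ] [LinearOrder Λ]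
  {σ : StructureFunctions R H} (ℓ : H →* Λ)

/-- The largest value of `ℓ` on the support. -/
noncomputable def supVal (x : TwistedGroupRing σ) : WithZero Λ :=
  x.support.sup fun h => (ℓ h : WithZero Λ)

variable {ℓ}

theorem supVal_le_iff {x : TwistedGroupRing σ} {c : WithZero Λ} :
    supVal ℓ x ≤ c ↔ ∀ h ∈ x.support, (ℓ h : WithZero Λ) ≤ c :=
  Finset.sup_le_iff

theorem le_supVal {x : TwistedGroupRing σ} {h : H} (hh : h ∈ x.support) :
    (ℓ h : WithZero Λ) ≤ supVal ℓ x :=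
  Finset.le_sup (f := fun h => (ℓ h : WithZero Λ)) hh

theorem supVal_zero : supVal ℓ (0 : TwistedGroupRing σ) = 0 := Finset.sup_empty

theorem exists_supVal_eq {x : TwistedGroupRing σ} (hx : x ≠ 0) :
    ∃ h ∈ x.support, supVal ℓ x = ℓ h :=
  Finset.exists_mem_eq_sup _ (support_nonempty hx) _

theorem supVal_ne_zero {x : TwistedGroupRing σ} (hx : x ≠ 0) : supVal ℓ x ≠ 0 := by
  obtain ⟨h, -, e⟩ := exists_supVal_eq (ℓ := ℓ) hx
  rw [e]
  exact WithZero.coe_ne_zero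

theorem IsHomogeneous.supVal_eq {γ : Λ} {x : TwistedGroupRing σ} (h : IsHomogeneous ℓ γ x)
    (hx : x ≠ 0) : supVal ℓ x = γ := by
  obtain ⟨g, hg, e⟩ := exists_supVal_eq (ℓ := ℓ) hx
  rw [e, h g hg]

theorem supVal_single {h : H} {r : R} (hr : r ≠ 0) : supVal ℓ (single σ h r) = ℓ h :=
  (isHomogeneous_single h r).supVal_eq (single_ne_zero hr)

theorem supVal_add_le (x y : TwistedGroupRing σ) :
    supVal ℓ (x + y) ≤ max (supVal ℓ x) (supVal ℓ y) := by
  classical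
  refine supVal_le_iff.2 fun h hh => ?_
  rcases Finset.mem_union.1 (Finsupp.support_add hh) with h1 | h1
  · exact (le_supVal h1).trans (le_max_left _ _)
  · exact (le_supVal h1).trans (le_max_right _ _)

theorem supVal_add_of_lt {x y : TwistedGroupRing σ} (h : supVal ℓ y < supVal ℓ x) :
    supVal ℓ (x + y) = supVal ℓ x := by
  have hx : x ≠ 0 := fun h0 => by simp [h0, supVal_zero] at h
  obtain ⟨g, hg, e⟩ := exists_supVal_eq (ℓ := ℓ) hx
  refine le_antisymm ((supVal_add_le x y).trans (max_le le_rfl h.le)) ?_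
  rw [e] at h ⊢
  have hy : g ∉ y.support := fun h' => (le_supVal h').not_gt h
  refine le_supVal (mem_support.2 ?_)
  rw [coeff_add, Finsupp.add_apply, not_not.1 fun h' => hy (mem_support.2 h'), add_zero]
  exact mem_support.1 hg

/-- Splitting off the leading part with respect to `ℓ`. -/
theorem exists_leading_part {x : TwistedGroupRing σ} (hx : x ≠ 0) :
    ∃ (α : Λ) (t y : TwistedGroupRing σ), x = t + y ∧ t ≠ 0 ∧ IsHomogeneous ℓ α t ∧
      supVal ℓ x = α ∧ supVal ℓ y < α := by
  classical
  obtain ⟨g, hg, e⟩ := exists_supVal_eq (ℓ := ℓ) hx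
  have ht : ∀ h, (component ℓ (ℓ g) x).coeff h = if ℓ h = ℓ g then x.coeff h else 0 :=
    fun h => by rw [component, Finsupp.filter_apply]; congr
  refine ⟨ℓ g, component ℓ (ℓ g) x, x - component ℓ (ℓ g) x, by abel, fun h0 => ?_,
    isHomogeneous_component _ _, e, ?_⟩
  · have := ht g
    rw [h0, if_pos rfl] at this
    exact mem_support.1 hg this.symm
  · have h1 : ∀ h ∈ (x - component ℓ (ℓ g) x).support, (ℓ h : WithZero Λ) < ℓ g := by
      intro h hh
      have h2 : (x - component ℓ (ℓ g) x).coeff h =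
          x.coeff h - (component ℓ (ℓ g) x).coeff h := by
        have h3 := congrArg (fun z => z.coeff h)
          (sub_add_cancel x (component ℓ (ℓ g) x))
        simp only [coeff_add, Finsupp.add_apply] at h3
        exact eq_sub_of_add_eq h3
      rw [mem_support, h2, ht] at hh
      by_cases hlg : ℓ h = ℓ g
      · simp [hlg] at hh
      · rw [if_neg hlg, sub_zero] at hh
        refine lt_of_le_of_ne (e ▸ le_supVal (mem_support.2 hh)) ?_
        exact_mod_cast hlg
    exact (Finset.sup_lt_iff (WithZero.zero_lt_coe _)).2 h1

variable [IsOrderedMonoid Λ]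

theorem supVal_mul_le (x y : TwistedGroupRing σ) :
    supVal ℓ (x * y) ≤ supVal ℓ x * supVal ℓ y := by
  classical
  refine supVal_le_iff.2 fun h hh => ?_
  obtain ⟨a, ha, b, hb, rfl⟩ := Finset.mem_mul.1 (support_mul_subset x y hh)
  rw [map_mul, WithZero.coe_mul]
  exact mul_le_mul' (le_supVal ha) (le_supVal hb)

variable [IsMulTorsionFree H] [Group.FG H]

theorem supVal_mul (x y : TwistedGroupRing σ) :
    supVal ℓ (x * y) = supVal ℓ x * supVal ℓ y := by
  by_cases hx : x = 0
  · rw [hx, zero_mul, supVal_zero, zero_mul]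
  by_cases hy : y = 0
  · rw [hy, mul_zero, supVal_zero, mul_zero]
  obtain ⟨α, t, x', hxt, ht, htα, hxα, hx'⟩ := exists_leading_part (ℓ := ℓ) hx
  obtain ⟨β, u, y', hyu, hu, huβ, hyβ, hy'⟩ := exists_leading_part (ℓ := ℓ) hy
  have htu : supVal ℓ (t * u) = α * β := by
    rw [(htα.mul huβ).supVal_eq (mul_ne_zero ht hu), WithZero.coe_mul]
  have e : x * y = t * u + (t * y' + x' * y) := by
    rw [hxt, hyu]; noncomm_ring
  have h1 : supVal ℓ (t * y') < α * β := by
    refine (supVal_mul_le _ _).trans_lt ?_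
    rw [htα.supVal_eq ht]
    exact mul_lt_mul_of_pos_left hy' (WithZero.zero_lt_coe _)
  have h2 : supVal ℓ (x' * y) < α * β := by
    refine (supVal_mul_le _ _).trans_lt ?_
    rw [hyβ]
    exact mul_lt_mul_of_pos_right hx' (WithZero.zero_lt_coe _)
  rw [e, supVal_add_of_lt, htu, hxα, hyβ]
  rw [htu]
  exact (supVal_add_le _ _).trans_lt (max_lt h1 h2)

variable (ℓ) in
/-- The valuation of the twisted group ring given by the largest value of `ℓ` on the support. -/
noncomputable def supValuation : Valuation (TwistedGroupRing σ) (WithZero Λ) where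
  toFun := supVal ℓ
  map_zero' := supVal_zero
  map_one' := by rw [one_def, supVal_single (Units.ne_zero _), map_one, WithZero.coe_one]
  map_mul' := supVal_mul
  map_add_le_max' := supVal_add_le

/-- Extension of a multiplicative map to the Ore localisation, as a monoid homomorphism. -/
noncomputable def extendToOreMonoidHom {C : Type*} [CommGroupWithZero C]
    (f : TwistedGroupRing σ →*₀ C) (hf : ∀ x, x ≠ 0 → f x ≠ 0) : OreField σ →* C :=
  OreLocalization.universalMulHom (f : TwistedGroupRing σ →* C)
    (Units.liftRight ((f : TwistedGroupRing σ →* C).comp (Submonoid.subtype _))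
      (fun s => Units.mk0 (f s) (hf _ (nonZeroDivisors.ne_zero s.2))) fun _ => rfl) fun _ => rfl

theorem extendToOreMonoidHom_toOreField {C : Type*} [CommGroupWithZero C]
    (f : TwistedGroupRing σ →*₀ C) (hf : ∀ x, x ≠ 0 → f x ≠ 0) (x : TwistedGroupRing σ) :
    extendToOreMonoidHom f hf (toOreField σ x) = f x := by
  rw [extendToOreMonoidHom]
  exact OreLocalization.universalMulHom_commutes _ _ (fun _ => rfl)

/-- Extension of a multiplicative map to the Ore localisation. -/
noncomputable def extendToOre {C : Type*} [CommGroupWithZero C] (f : TwistedGroupRing σ →*₀ C)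
    (hf : ∀ x, x ≠ 0 → f x ≠ 0) : OreField σ →*₀ C where
  __ := extendToOreMonoidHom f hf
  map_zero' := by
    have h := extendToOreMonoidHom_toOreField f hf 0
    rwa [map_zero (toOreField σ), map_zero f] at h

theorem extendToOre_toOreField {C : Type*} [CommGroupWithZero C]
    (f : TwistedGroupRing σ →*₀ C) (hf : ∀ x, x ≠ 0 → f x ≠ 0) (x : TwistedGroupRing σ) :
    extendToOre f hf (toOreField σ x) = f x :=
  extendToOreMonoidHom_toOreField f hf x

theorem toOreField_ne_zero {x : TwistedGroupRing σ} (hx : x ≠ 0) : toOreField σ x ≠ 0 := by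
  intro h
  have h1 := extendToOre_toOreField
    ((supValuation (σ := σ) (1 : H →* Multiplicative ℤ)).toMonoidWithZeroHom)
    (fun _ hx => supVal_ne_zero hx) x
  rw [h, map_zero] at h1
  exact supVal_ne_zero hx h1.symm

/-- Every element of the Ore localisation is a left fraction. -/
theorem exists_eq_inv_mul (z : OreField σ) :
    ∃ s a : TwistedGroupRing σ, s ≠ 0 ∧ z = (toOreField σ s)⁻¹ * toOreField σ a := by
  induction z using OreLocalization.ind with
  | _ a s =>
  refine ⟨s, a, nonZeroDivisors.ne_zero s.2, ?_⟩
  rw [eq_inv_mul_iff_mul_eq₀ (toOreField_ne_zero (nonZeroDivisors.ne_zero s.2))]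
  exact OreLocalization.mul_cancel

variable (ℓ) (σ) in
/-- The extension of `supValuation` to the Ore localisation. -/
noncomputable def oreValuation : Valuation (OreField σ) (WithZero Λ) where
  toMonoidWithZeroHom := extendToOre (supValuation ℓ).toMonoidWithZeroHom
    fun _ hx => supVal_ne_zero hx
  map_add_le_max' := by
    set v := extendToOre (supValuation (σ := σ) ℓ).toMonoidWithZeroHom
      fun _ hx => supVal_ne_zero hx
    change ∀ x y, v (x + y) ≤ max (v x) (v y)
    have hv : ∀ x, v (toOreField σ x) = supVal ℓ x := fun x => extendToOre_toOreField _ _ x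
    have h1 : ∀ z, v (1 + z) ≤ max 1 (v z) := by
      intro z
      obtain ⟨s, a, hs, rfl⟩ := exists_eq_inv_mul z
      have hs' := toOreField_ne_zero hs
      have h2 : 1 + (toOreField σ s)⁻¹ * toOreField σ a =
          (toOreField σ s)⁻¹ * toOreField σ (s + a) := by
        rw [map_add, mul_add, inv_mul_cancel₀ hs']
      rw [h2, map_mul, map_mul, map_inv₀, hv, hv, hv]
      have h3 := mul_le_mul_right (supVal_add_le (ℓ := ℓ) s a) (supVal ℓ s)⁻¹
      rwa [mul_max, inv_mul_cancel₀ (supVal_ne_zero hs)] at h3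
    intro x y
    by_cases hx : x = 0
    · simp [hx]
    have h2 : x + y = x * (1 + x⁻¹ * y) := by rw [mul_add, mul_one, mul_inv_cancel_left₀ hx]
    have h3 := mul_le_mul_right (h1 (x⁻¹ * y)) (v x)
    rwa [← map_mul, ← h2, mul_max, mul_one, ← map_mul, mul_inv_cancel_left₀ hx] at h3

@[simp] theorem oreValuation_toOreField (x : TwistedGroupRing σ) :
    oreValuation σ ℓ (toOreField σ x) = supVal ℓ x :=
  extendToOre_toOreField _ (fun _ hx => supVal_ne_zero hx) x

end Valuation

end TwistedGroupRing

namespace TwistedGroupRing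

section Width

open Multiplicative

variable {R H : Type*} [DivisionRing R] [CommGroup H] {σ : StructureFunctions R H}
  (ψ χ : H →* Multiplicative ℤ)

/-- The pair of two homomorphisms to `ℤ`, with values in `ℤ × ℤ` with the lexicographic order. -/
def lexHom : H →* Multiplicative ℤ ×ₗ Multiplicative ℤ where
  toFun h := toLex (ψ h, χ h)
  map_one' := by rw [map_one, map_one]; rfl
  map_mul' a b := by rw [map_mul, map_mul]; rfl

/-- The second projection. -/
def lexSnd : (Multiplicative ℤ ×ₗ Multiplicative ℤ) →* Multiplicative ℤ where
  toFun x := (ofLex x).2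
  map_one' := rfl
  map_mul' _ _ := rfl

variable {ψ χ}

theorem IsHomogeneous.lexHom_inv {a b : Multiplicative ℤ} {x : TwistedGroupRing σ}
    (hx : IsHomogeneous (lexHom ψ χ) (toLex (a, b)) x) :
    IsHomogeneous (lexHom ψ χ⁻¹) (toLex (a, b⁻¹)) x := by
  intro h hh
  have h1 := congrArg ofLex (hx h hh)
  change (ψ h, χ h) = (a, b) at h1
  rw [Prod.mk.injEq] at h1
  change toLex (ψ h, (χ h)⁻¹) = _
  rw [h1.1, h1.2]

theorem IsHomogeneous.of_lexHom {a b : Multiplicative ℤ} {x : TwistedGroupRing σ}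
    (hx : IsHomogeneous (lexHom ψ χ) (toLex (a, b)) x) : IsHomogeneous ψ a x := by
  intro h hh
  have h1 := congrArg ofLex (hx h hh)
  change (ψ h, χ h) = (a, b) at h1
  rw [Prod.mk.injEq] at h1
  exact h1.1

theorem IsHomogeneous.supVal_le {Λ : Type*} [CommGroup Λ] [LinearOrder Λ] {ℓ : H →* Λ} {γ : Λ}
    {x : TwistedGroupRing σ} (h : IsHomogeneous ℓ γ x) : supVal ℓ x ≤ γ :=
  supVal_le_iff.2 fun g hg => by rw [h g hg]

variable (ψ χ) in
/-- The face of the support of `x` on which `ψ` is maximal has maximal `ψ`-value `a`, maximal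
`χ`-value `b` and minimal `χ`-value `c⁻¹`. -/
theorem exists_supVal_lexHom {x : TwistedGroupRing σ} (hx : x ≠ 0) :
    ∃ a b c : Multiplicative ℤ, supVal ψ x = a ∧ supVal (lexHom ψ χ) x = ↑(toLex (a, b)) ∧
      supVal (lexHom ψ χ⁻¹) x = ↑(toLex (a, c)) ∧ 1 ≤ b * c := by
  obtain ⟨g, hg, e⟩ := exists_supVal_eq (ℓ := lexHom ψ χ) hx
  obtain ⟨g', hg', e'⟩ := exists_supVal_eq (ℓ := lexHom ψ χ⁻¹) hx
  have h1 : ∀ h ∈ x.support, ψ h < ψ g ∨ ψ h = ψ g ∧ χ h ≤ χ g := fun h hh => by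
    have := (le_supVal (ℓ := lexHom ψ χ) hh).trans_eq e
    rw [WithZero.coe_le_coe] at this
    exact (Prod.Lex.toLex_le_toLex).1 this
  have h2 : ∀ h ∈ x.support, ψ h < ψ g' ∨ ψ h = ψ g' ∧ (χ h)⁻¹ ≤ (χ g')⁻¹ := fun h hh => by
    have := (le_supVal (ℓ := lexHom ψ χ⁻¹) hh).trans_eq e'
    rw [WithZero.coe_le_coe] at this
    exact (Prod.Lex.toLex_le_toLex).1 this
  have h3 : ψ g = ψ g' := by
    rcases h1 g' hg' with h | h
    · rcases h2 g hg with h' | h'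
      · exact absurd h' h.not_gt
      · exact h'.1
    · exact h.1.symm
  refine ⟨ψ g, χ g, (χ g')⁻¹, ?_, e, ?_, ?_⟩
  · refine le_antisymm (supVal_le_iff.2 fun h hh => ?_) (le_supVal hg)
    rw [WithZero.coe_le_coe]
    exact (h1 h hh).elim le_of_lt fun h => h.1.le
  · rw [e', h3]
    rfl
  · rcases h2 g hg with h | h
    · exact absurd h3 h.ne
    · have := mul_le_mul_right h.2 (χ g)
      rwa [mul_inv_cancel] at this

variable [IsMulTorsionFree H] [Group.FG H]

variable (σ ψ χ) in
/-- The difference between the maximal and the minimal `χ`-value on the face on which `ψ` is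
maximal, extended to the Ore localisation. -/
noncomputable def width : OreField σ →*₀ WithZero (Multiplicative ℤ) where
  toFun x := WithZero.map' lexSnd (oreValuation σ (lexHom ψ χ) x) *
    WithZero.map' lexSnd (oreValuation σ (lexHom ψ χ⁻¹) x)
  map_zero' := by simp
  map_one' := by simp
  map_mul' x y := by rw [map_mul, map_mul, map_mul, map_mul, mul_mul_mul_comm]

theorem width_toOreField_of_supVal {x : TwistedGroupRing σ} {a b a' c : Multiplicative ℤ}
    (h1 : supVal (lexHom ψ χ) x = ↑(toLex (a, b)))
    (h2 : supVal (lexHom ψ χ⁻¹) x = ↑(toLex (a', c))) :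
    width σ ψ χ (toOreField σ x) = ↑(b * c) := by
  change WithZero.map' lexSnd (oreValuation σ (lexHom ψ χ) (toOreField σ x)) *
    WithZero.map' lexSnd (oreValuation σ (lexHom ψ χ⁻¹) (toOreField σ x)) = _
  rw [oreValuation_toOreField, oreValuation_toOreField, h1, h2, WithZero.map'_coe,
    WithZero.map'_coe, WithZero.coe_mul]
  rfl

variable (ψ χ) in
theorem one_le_width {x : TwistedGroupRing σ} (hx : x ≠ 0) :
    1 ≤ width σ ψ χ (toOreField σ x) := by
  obtain ⟨a, b, c, -, h1, h2, h3⟩ := exists_supVal_lexHom ψ χ hx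
  rw [width_toOreField_of_supVal h1 h2]
  exact_mod_cast h3

theorem width_homogeneous {a b : Multiplicative ℤ} {x : TwistedGroupRing σ}
    (h : IsHomogeneous (lexHom ψ χ) (toLex (a, b)) x) (hx : x ≠ 0) :
    width σ ψ χ (toOreField σ x) = 1 := by
  rw [width_toOreField_of_supVal (h.supVal_eq hx) (h.lexHom_inv.supVal_eq hx), mul_inv_cancel]
  rfl

theorem width_single (g : H) {r : R} (hr : r ≠ 0) :
    width σ ψ χ (toOreField σ (single σ g r)) = 1 :=
  width_homogeneous (a := ψ g) (b := χ g) (isHomogeneous_single g r) (single_ne_zero hr)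

theorem width_neg_one : width σ ψ χ (-1) = 1 := by
  change WithZero.map' lexSnd (oreValuation σ (lexHom ψ χ) (-1)) *
    WithZero.map' lexSnd (oreValuation σ (lexHom ψ χ⁻¹) (-1)) = _
  simp [Valuation.map_neg]

theorem map_fst_oreValuation (x : OreField σ) :
    oreValuation σ ψ x = WithZero.map' (OrderMonoidHom.fstₗ _ _ : _ →*o Multiplicative ℤ).toMonoidHom
      (oreValuation σ (lexHom ψ χ) x) := by
  obtain ⟨s, y, hs, rfl⟩ := exists_eq_inv_mul x
  have h : ∀ z : TwistedGroupRing σ, oreValuation σ ψ (toOreField σ z) =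
      WithZero.map' (OrderMonoidHom.fstₗ _ _ : _ →*o Multiplicative ℤ).toMonoidHom
      (oreValuation σ (lexHom ψ χ) (toOreField σ z)) := fun z => by
    by_cases hz : z = 0
    · simp [hz]
    · obtain ⟨a, b, c, h0, h1, h2, h3⟩ := exists_supVal_lexHom ψ χ hz
      rw [oreValuation_toOreField, oreValuation_toOreField, h0, h1, WithZero.map'_coe]
      rfl
  simp only [map_mul, map_inv₀, h]

theorem oreValuation_lexHom_lt {x y : OreField σ} (h : oreValuation σ ψ y < oreValuation σ ψ x) :
    oreValuation σ (lexHom ψ χ) y < oreValuation σ (lexHom ψ χ) x := by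
  by_contra! h'
  refine h.not_ge ?_
  rw [map_fst_oreValuation (χ := χ), map_fst_oreValuation (χ := χ) y]
  exact WithZero.map'_mono (OrderMonoidHom.monotone' _) h'

theorem width_add_of_lt {x y : OreField σ} (h : oreValuation σ ψ y < oreValuation σ ψ x) :
    width σ ψ χ (x + y) = width σ ψ χ x := by
  change WithZero.map' lexSnd (oreValuation σ (lexHom ψ χ) (x + y)) *
    WithZero.map' lexSnd (oreValuation σ (lexHom ψ χ⁻¹) (x + y)) = _
  rw [Valuation.map_add_eq_of_lt_left _ (oreValuation_lexHom_lt h),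
    Valuation.map_add_eq_of_lt_left _ (oreValuation_lexHom_lt h)]
  rfl

open Classical in
variable (ψ χ) in
/-- A measure of the size of the part of `x` on which `ψ` vanishes. -/
noncomputable def residueSize (x : TwistedGroupRing σ) : ℕ :=
  if supVal ψ x = 1 then (WithZero.log (width σ ψ χ (toOreField σ x))).toNat + 1 else 0

/-- Division with remainder, up to a factor which is a unit at the level of `ψ` and `χ`. -/
theorem exists_pseudo_division {x y : TwistedGroupRing σ} (hx : supVal ψ x = 1)
    (hy : supVal ψ y = 1)
    (hxy : width σ ψ χ (toOreField σ y) ≤ width σ ψ χ (toOreField σ x)) :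
    ∃ q p : TwistedGroupRing σ, q ≠ 0 ∧ supVal ψ q = 1 ∧ width σ ψ χ (toOreField σ q) = 1 ∧
      supVal ψ p ≤ 1 ∧ residueSize ψ χ (q * x - p * y) < residueSize ψ χ x := by
  have ne : ∀ {z : TwistedGroupRing σ}, supVal ψ z = 1 → z ≠ 0 := fun h h0 => by
    simp [h0, supVal_zero] at h
  obtain ⟨a₁, b₁, c₁, ha₁, hb₁, hc₁, hbc₁⟩ := exists_supVal_lexHom ψ χ (ne hx)
  obtain ⟨a₂, b₂, c₂, ha₂, hb₂, hc₂, hbc₂⟩ := exists_supVal_lexHom ψ χ (ne hy)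
  obtain rfl : a₁ = 1 := by rw [hx] at ha₁; exact_mod_cast ha₁.symm
  obtain rfl : a₂ = 1 := by rw [hy] at ha₂; exact_mod_cast ha₂.symm
  rw [width_toOreField_of_supVal hb₁ hc₁, width_toOreField_of_supVal hb₂ hc₂,
    WithZero.coe_le_coe] at hxy
  obtain ⟨α, t, x', hxt, ht, htα, hα, hx'⟩ := exists_leading_part (ℓ := lexHom ψ χ) (ne hx)
  obtain ⟨β, u, y', hyu, hu, huβ, hβ, hy'⟩ := exists_leading_part (ℓ := lexHom ψ χ) (ne hy)
  obtain rfl : α = toLex (1, b₁) := by rw [hb₁] at hα; exact_mod_cast hα.symm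
  obtain rfl : β = toLex (1, b₂) := by rw [hb₂] at hβ; exact_mod_cast hβ.symm
  obtain ⟨q, p, hq, hq1, hp, hqp⟩ := exists_homogeneous_ore htα huβ hu
  have hq1' : IsHomogeneous (lexHom ψ χ) (toLex (1, 1)) q := hq1
  have hp' : IsHomogeneous (lexHom ψ χ) (toLex (1, b₁ * b₂⁻¹)) p := by
    have e : toLex ((1 : Multiplicative ℤ), b₁) * (toLex ((1 : Multiplicative ℤ), b₂))⁻¹ =
      toLex (1, b₁ * b₂⁻¹) := rfl
    rwa [e] at hp
  have hz : q * x - p * y = q * x' + (-p) * y' := by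
    rw [hxt, hyu, mul_add, mul_add, hqp]
    noncomm_ring
  have hpn : ∀ (ℓ : H →* Multiplicative ℤ ×ₗ Multiplicative ℤ) z,
      supVal ℓ ((-p) * z) = supVal ℓ p * supVal ℓ z := fun ℓ z => by
    have h := Valuation.map_neg (supValuation (σ := σ) ℓ) (p * z)
    rw [neg_mul]
    exact h.trans (supVal_mul p z)
  have h1 : supVal (lexHom ψ χ) (q * x - p * y) < ↑(toLex ((1 : Multiplicative ℤ), b₁)) := by
    rw [hz]
    refine (supVal_add_le _ _).trans_lt (max_lt ?_ ?_)
    · rw [supVal_mul, hq1.supVal_eq hq, WithZero.coe_one, one_mul]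
      exact hx'
    · rw [hpn]
      by_cases hp0 : p = 0
      · rw [hp0, supVal_zero, zero_mul]
        exact WithZero.zero_lt_coe _
      · rw [hp.supVal_eq hp0]
        refine (mul_lt_mul_of_pos_left hy' (WithZero.zero_lt_coe _)).trans_eq ?_
        rw [← WithZero.coe_mul, inv_mul_cancel_right]
  have h2 : supVal (lexHom ψ χ⁻¹) (q * x - p * y) ≤ ↑(toLex ((1 : Multiplicative ℤ), c₁)) := by
    rw [sub_eq_add_neg, ← neg_mul]
    refine (supVal_add_le _ _).trans (max_le ?_ ?_)
    · rw [supVal_mul, hq1'.lexHom_inv.supVal_eq hq, hc₁, ← WithZero.coe_mul, WithZero.coe_le_coe]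
      change toLex ((1 : Multiplicative ℤ) * 1, 1⁻¹ * c₁) ≤ _
      rw [mul_one, inv_one, one_mul]
    · rw [hpn, hc₂]
      refine (mul_le_mul_left hp'.lexHom_inv.supVal_le _).trans ?_
      rw [← WithZero.coe_mul, WithZero.coe_le_coe]
      change toLex ((1 : Multiplicative ℤ) * 1, (b₁ * b₂⁻¹)⁻¹ * c₂) ≤ _
      refine Prod.Lex.toLex_le_toLex.2 (Or.inr ⟨mul_one 1, ?_⟩)
      change (b₁ * b₂⁻¹)⁻¹ * c₂ ≤ c₁
      rw [mul_inv, inv_inv, mul_assoc, inv_mul_le_iff_le_mul]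
      exact hxy
  refine ⟨q, p, hq, hq1'.of_lexHom.supVal_eq hq, width_homogeneous hq1' hq,
    hp'.of_lexHom.supVal_le, ?_⟩
  rw [residueSize, residueSize, if_pos hx]
  split_ifs with h3
  · obtain ⟨a₃, b₃, c₃, ha₃, hb₃, hc₃, hbc₃⟩ := exists_supVal_lexHom ψ χ (ne h3)
    obtain rfl : a₃ = 1 := by rw [h3] at ha₃; exact_mod_cast ha₃.symm
    rw [width_toOreField_of_supVal hb₁ hc₁, width_toOreField_of_supVal hb₃ hc₃]
    rw [hb₃, WithZero.coe_lt_coe, Prod.Lex.toLex_lt_toLex] at h1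
    rw [hc₃, WithZero.coe_le_coe, Prod.Lex.toLex_le_toLex] at h2
    have h4 : b₃ < b₁ := by simpa using h1
    have h5 : c₃ ≤ c₁ := by simpa using h2
    have h6 : b₃ * c₃ < b₁ * c₁ := mul_lt_mul_of_lt_of_le h4 h5
    have h7 : toAdd (b₃ * c₃) < toAdd (b₁ * c₁) := h6
    have h8 : 0 ≤ toAdd (b₃ * c₃) := hbc₃
    change (toAdd (b₃ * c₃)).toNat + 1 < (toAdd (b₁ * c₁)).toNat + 1
    omega
  · exact Nat.succ_pos _

end Width

end TwistedGroupRing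

section RowDetValuation

variable {D : Type*} [DivisionRing D]

theorem rowDet_ne_zero {C : Type*} [CommGroupWithZero C] {w : D →*₀ C} (hw : w (-1) = 1) {n : ℕ}
    {A : Fin n → Fin n → D} (hA : LinearIndependent D A) : rowDet w n A ≠ 0 := by
  refine LinearIndependent.update_induction (P := fun A => rowDet w n A ≠ 0)
    (fun X hX ih i c hc => ?_) (linearIndependent_single n) ?_ hA
  · rw [rowDet_update hw hX i c hc]
    exact mul_ne_zero ((map_ne_zero w).2 hc) ih
  · rw [rowDet_single hw]
    exact one_ne_zero

theorem rowDet_smul_rows {C : Type*} [CommGroupWithZero C] {w : D →*₀ C} (hw : w (-1) = 1)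
    {n : ℕ} {A : Fin n → Fin n → D} (hA : LinearIndependent D A) {u : D} (hu : u ≠ 0)
    (hwu : w u = 1) (s : Finset (Fin n)) :
    rowDet w n (fun k => if k ∈ s then u • A k else A k) = rowDet w n A ∧
      LinearIndependent D (fun k => if k ∈ s then u • A k else A k) := by
  induction s using Finset.induction_on with
  | empty => simpa using hA
  | insert a s ha ih =>
    obtain ⟨ih1, ih2⟩ := ih
    have h := rowDet_update_smul_of_law (fun _ h => rowDet_update hw h) ih2 a hu
    have h1 : (fun k => if k ∈ insert a s then u • A k else A k) =
        Function.update (fun k => if k ∈ s then u • A k else A k) a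
          (u • (fun k => if k ∈ s then u • A k else A k) a) := by
      funext k
      by_cases hk : k = a
      · subst hk
        simp [ha]
      · simp [hk]
    rw [h1]
    rwa [hwu, one_mul, ih1] at h

theorem rowDet_valuation_le_one {Γ : Type*} [LinearOrderedCommGroupWithZero Γ]
    (v : Valuation D Γ) {n : ℕ} {A : Fin n → Fin n → D} (hA : LinearIndependent D A)
    (h : ∀ i j, v (A i j) ≤ 1) : rowDet v.toMonoidWithZeroHom n A ≤ 1 := by
  have hw : v.toMonoidWithZeroHom (-1) = 1 := by
    change v (-1) = 1
    rw [Valuation.map_neg, map_one]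
  induction n with
  | zero => exact le_rfl
  | succ n ih =>
    obtain ⟨l, hl⟩ := hA.exists_sum_smul_eq (Pi.single (Fin.last n) 1)
    obtain ⟨i, hi⟩ : ∃ i, 1 ≤ v (l i) := by
      by_contra! hlt
      have h1 := congrFun hl (Fin.last n)
      rw [Finset.sum_apply, Pi.single_eq_same] at h1
      have h2 : v (∑ m, (l m • A m) (Fin.last n)) < 1 := by
        refine v.map_sum_lt one_ne_zero fun m _ => ?_
        rw [Pi.smul_apply, smul_eq_mul, map_mul]
        exact (mul_le_of_le_one_right' (h m _)).trans_lt (hlt m)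
      rw [h1, map_one] at h2
      exact h2.false
    have hi0 : l i ≠ 0 := fun h0 => by
      rw [h0, map_zero] at hi
      exact zero_lt_one.not_ge hi
    rw [rowDet_succ hw hA hl hi0]
    refine mul_le_one' (ih (hA.rowMinor hl hi0) fun k m => h _ _) ?_
    exact inv_le_one_of_one_le₀ hi

theorem map_dieudonneRep_of_triangular {Γ C : Type*} [LinearOrderedCommGroupWithZero Γ]
    [CommGroupWithZero C] (v : Valuation D Γ) {w : D →*₀ C}
    (hvw : ∀ x y, v y < v x → w (x + y) = w x) {n : ℕ} {A : Matrix (Fin n) (Fin n) D}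
    (h : ∀ i j, v (A i j) ≤ 1) (hd : ∀ i, v (A i i) = 1) (ht : ∀ i j, j < i → v (A i j) < 1) :
    w (dieudonneRep n A) = ∏ i, w (A i i) := by
  classical
  induction n with
  | zero => simp [dieudonneRep]
  | succ n ih =>
    have hb : A (Fin.last n) (Fin.last n) ≠ 0 := fun h0 => by
      have := hd (Fin.last n)
      rw [h0, map_zero] at this
      exact zero_ne_one this
    have hex : ∃ j, A (Fin.last n) j ≠ 0 := ⟨_, hb⟩
    rw [dieudonneRep, dif_pos hex]
    extract_lets j B b d
    have hj : j = Fin.last n := by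
      refine le_antisymm (Fin.le_last _) (Finset.le_max' _ _ ?_)
      simpa using hb
    have hB : B = A := by
      ext k m
      simp [B, hj]
    have hx : ∀ k l : Fin n, v (A k.castSucc (Fin.last n) * (A (Fin.last n) (Fin.last n))⁻¹ *
        A (Fin.last n) l.castSucc) < 1 := fun k l => by
      rw [map_mul, map_mul, map_inv₀, hd, inv_one, mul_one]
      exact (mul_le_of_le_one_left' (h _ _)).trans_lt (ht _ _ (Fin.castSucc_lt_last l))
    rw [if_pos hj, map_mul, Fin.prod_univ_castSucc]
    simp only [b, hB]
    congr 1
    refine (ih (fun k l => ?_) (fun k => ?_) fun k l hlk => ?_).trans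
      (Finset.prod_congr rfl fun k _ => ?_)
    · exact (v.map_sub _ _).trans (max_le (h _ _) (hx k l).le)
    · rw [Valuation.map_sub_eq_of_lt_left, hd]
      rw [hd]
      exact hx k k
    · exact (v.map_sub _ _).trans_lt (max_lt (ht _ _ (by simpa using hlk)) (hx k l))
    · rw [sub_eq_add_neg, hvw]
      rw [Valuation.map_neg, hd]
      exact hx k k

end RowDetValuation

namespace TwistedGroupRing

section Descent

variable {R H : Type*} [DivisionRing R] [CommGroup H] [IsMulTorsionFree H] [Group.FG H]
  {σ : StructureFunctions R H} {ψ χ : H →* Multiplicative ℤ}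

/-- The row operation `A i ↦ q A i - p A j`. -/
noncomputable def rowOp {n : ℕ} (A : Fin n → Fin n → TwistedGroupRing σ) (i j : Fin n)
    (q p : TwistedGroupRing σ) : Fin n → Fin n → TwistedGroupRing σ :=
  Function.update A i fun k => q * A i k - p * A j k

theorem rowDet_rowOp {C : Type*} [CommGroupWithZero C] {w : OreField σ →*₀ C} (hw : w (-1) = 1)
    {n : ℕ} {A : Fin n → Fin n → TwistedGroupRing σ}
    (hA : LinearIndependent (OreField σ) fun i k => toOreField σ (A i k)) {i j : Fin n}
    (hij : i ≠ j) {q : TwistedGroupRing σ} (hq : q ≠ 0) (p : TwistedGroupRing σ) :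
    rowDet w n (fun m k => toOreField σ (rowOp A i j q p m k)) =
        w (toOreField σ q) * rowDet w n (fun i k => toOreField σ (A i k)) ∧
      LinearIndependent (OreField σ) fun m k => toOreField σ (rowOp A i j q p m k) := by
  let c : Fin n → OreField σ := Pi.single i (toOreField σ q) + Pi.single j (-toOreField σ p)
  have hc : c i = toOreField σ q := by simp [c, hij]
  have hc0 : c i ≠ 0 := by rw [hc]; exact toOreField_ne_zero hq
  have h : (fun m k => toOreField σ (rowOp A i j q p m k)) =
      Function.update (fun i k => toOreField σ (A i k)) i
        (∑ m, c m • fun k => toOreField σ (A m k)) := by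
    funext m k
    by_cases hm : m = i
    · subst hm
      simp [rowOp, c, add_mul, Finset.sum_add_distrib, Pi.single_apply, ite_mul, sub_eq_add_neg]
    · simp [rowOp, hm]
  rw [h, ← hc]
  exact ⟨rowDet_update hw hA i c hc0, hA.update_sum hc0⟩

theorem rowDet_smul_row {C : Type*} [CommGroupWithZero C] {w : OreField σ →*₀ C}
    (hw : w (-1) = 1) {n : ℕ} {A : Fin n → Fin n → TwistedGroupRing σ}
    (hA : LinearIndependent (OreField σ) fun i k => toOreField σ (A i k)) (i : Fin n)
    {u : TwistedGroupRing σ} (hu : u ≠ 0) :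
    rowDet w n (fun m k => toOreField σ (Function.update A i (fun k => u * A i k) m k)) =
        w (toOreField σ u) * rowDet w n (fun i k => toOreField σ (A i k)) ∧
      LinearIndependent (OreField σ)
        fun m k => toOreField σ (Function.update A i (fun k => u * A i k) m k) := by
  have h : (fun m k => toOreField σ (Function.update A i (fun k => u * A i k) m k)) =
      Function.update (fun i k => toOreField σ (A i k)) i
        (toOreField σ u • fun k => toOreField σ (A i k)) := by
    funext m k
    by_cases hm : m = i
    · subst hm
      simp
    · simp [hm]
  rw [h]
  exact rowDet_update_smul_of_law (fun _ h => rowDet_update hw h) hA i (toOreField_ne_zero hu)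

/-- Row echelon form, up to entries on which `ψ` is negative, of the first `k` columns with
`r` pivots. -/
structure IsEchelon (ψ : H →* Multiplicative ℤ) {n : ℕ} (A : Fin n → Fin n → TwistedGroupRing σ)
    (r k : ℕ) : Prop where
  le : r ≤ k
  below : ∀ i j : Fin n, r ≤ i → (j : ℕ) < k → supVal ψ (A i j) < 1
  diag : r = k → ∀ i : Fin n, (i : ℕ) < k → supVal ψ (A i i) = 1
  triangular : r = k → ∀ i j : Fin n, (j : ℕ) < k → j < i → supVal ψ (A i j) < 1

/-- A non-singular matrix on which `ψ` is nowhere positive. -/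
structure IsAdmissible (ψ : H →* Multiplicative ℤ) {n : ℕ}
    (A : Fin n → Fin n → TwistedGroupRing σ) : Prop where
  supVal_le : ∀ i j, supVal ψ (A i j) ≤ 1
  linearIndependent : LinearIndependent (OreField σ) fun i k => toOreField σ (A i k)

variable (ψ) in
/-- The valuation given by `ψ` of the determinant. -/
noncomputable abbrev detVal {n : ℕ} (A : Fin n → Fin n → TwistedGroupRing σ) :
    WithZero (Multiplicative ℤ) :=
  rowDet (oreValuation σ ψ).toMonoidWithZeroHom n fun i k => toOreField σ (A i k)

variable (ψ χ) in
/-- The width of the determinant. -/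
noncomputable abbrev detWidth {n : ℕ} (A : Fin n → Fin n → TwistedGroupRing σ) :
    WithZero (Multiplicative ℤ) :=
  rowDet (width σ ψ χ) n fun i k => toOreField σ (A i k)

theorem oreValuation_neg_one : (oreValuation σ ψ).toMonoidWithZeroHom (-1) = 1 := by
  change oreValuation σ ψ (-1) = 1
  rw [Valuation.map_neg, map_one]

theorem oreValuation_toMonoidWithZeroHom (x : TwistedGroupRing σ) :
    (oreValuation σ ψ).toMonoidWithZeroHom (toOreField σ x) = supVal ψ x :=
  oreValuation_toOreField x

theorem IsAdmissible.rowOp {n : ℕ} {A : Fin n → Fin n → TwistedGroupRing σ}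
    (hA : IsAdmissible ψ A) {i j : Fin n} (hij : i ≠ j) {q p : TwistedGroupRing σ} (hq : q ≠ 0)
    (hq1 : supVal ψ q = 1) (hp : supVal ψ p ≤ 1) : IsAdmissible ψ (rowOp A i j q p) := by
  refine ⟨fun m k => ?_, (rowDet_rowOp (width_neg_one (ψ := ψ) (χ := ψ))
    hA.linearIndependent hij hq p).2⟩
  by_cases hm : m = i
  · subst hm
    simp only [TwistedGroupRing.rowOp, Function.update_self]
    refine (Valuation.map_sub (supValuation ψ) _ _).trans (max_le ?_ ?_)
    · exact (supVal_mul _ _).trans_le (mul_le_one' hq1.le (hA.supVal_le _ _))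
    · exact (supVal_mul _ _).trans_le (mul_le_one' hp (hA.supVal_le _ _))
  · simp only [TwistedGroupRing.rowOp, Function.update_of_ne hm]
    exact hA.supVal_le _ _

theorem IsAdmissible.comp_perm {n : ℕ} {A : Fin n → Fin n → TwistedGroupRing σ}
    (hA : IsAdmissible ψ A) (τ : Equiv.Perm (Fin n)) : IsAdmissible ψ (A ∘ τ) :=
  ⟨fun _ _ => hA.supVal_le _ _, hA.linearIndependent.comp τ τ.injective⟩

theorem IsEchelon.rowOp {n r k : ℕ} {A : Fin n → Fin n → TwistedGroupRing σ}
    (hA : IsEchelon ψ A r k) {i j : Fin n} (hi : r ≤ i) (hj : r ≤ j) {q p : TwistedGroupRing σ}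
    (hq1 : supVal ψ q = 1) (hp : supVal ψ p ≤ 1) : IsEchelon ψ (rowOp A i j q p) r k := by
  have h : ∀ l : Fin n, (l : ℕ) < k → supVal ψ (q * A i l - p * A j l) < 1 := fun l hl => by
    refine (Valuation.map_sub (supValuation ψ) _ _).trans_lt (max_lt ?_ ?_)
    · refine (supVal_mul _ _).trans_lt ?_
      rw [hq1, one_mul]
      exact hA.below i l hi hl
    · exact (supVal_mul _ _).trans_lt ((mul_le_of_le_one_left' hp).trans_lt (hA.below j l hj hl))
  refine ⟨hA.le, fun m l hm hl => ?_, fun hrk m hm => ?_, fun hrk m l hl hlm => ?_⟩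
  · by_cases hmi : m = i
    · subst hmi
      simpa only [TwistedGroupRing.rowOp, Function.update_self] using h l hl
    · simpa only [TwistedGroupRing.rowOp, Function.update_of_ne hmi] using hA.below m l hm hl
  · have hmi : m ≠ i := by rintro rfl; omega
    simpa only [TwistedGroupRing.rowOp, Function.update_of_ne hmi] using hA.diag hrk m hm
  · by_cases hmi : m = i
    · subst hmi
      simpa only [TwistedGroupRing.rowOp, Function.update_self] using h l hl
    · simpa only [TwistedGroupRing.rowOp, Function.update_of_ne hmi]
        using hA.triangular hrk m l hl hlm

/-- If `ψ` is negative on a row, then this row can be multiplied by some group element. -/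
theorem IsAdmissible.exists_detVal_lt {n : ℕ} {A : Fin n → Fin n → TwistedGroupRing σ}
    (hA : IsAdmissible ψ A) (i : Fin n) (hi : ∀ j, supVal ψ (A i j) < 1) :
    ∃ B : Fin n → Fin n → TwistedGroupRing σ, IsAdmissible ψ B ∧
      detWidth ψ χ B = detWidth ψ χ A ∧ detVal ψ A < detVal ψ B := by
  have hrow : ∃ j, A i j ≠ 0 := by
    by_contra! h
    refine hA.linearIndependent.ne_zero i (funext fun j => ?_)
    simp [h j]
  obtain ⟨j₀, hj₀⟩ := hrow
  obtain ⟨j, -, hj⟩ := Finset.exists_max_image Finset.univ (fun j => supVal ψ (A i j))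
    ⟨j₀, Finset.mem_univ _⟩
  have hAj : A i j ≠ 0 := fun h0 => by
    have := hj j₀ (Finset.mem_univ _)
    rw [h0, supVal_zero] at this
    exact supVal_ne_zero hj₀ (le_zero_iff.1 this)
  obtain ⟨g, -, hg⟩ := exists_supVal_eq (ℓ := ψ) hAj
  have hu : single σ g⁻¹ (1 : R) ≠ 0 := single_ne_zero one_ne_zero
  have hvu : supVal ψ (single σ g⁻¹ (1 : R)) = (supVal ψ (A i j))⁻¹ := by
    rw [supVal_single one_ne_zero, map_inv, WithZero.coe_inv, hg]
  have h0 : supVal ψ (A i j) ≠ 0 := supVal_ne_zero hAj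
  obtain ⟨e1, l1⟩ := rowDet_smul_row (oreValuation_neg_one (ψ := ψ)) hA.linearIndependent i hu
  obtain ⟨e2, -⟩ := rowDet_smul_row (width_neg_one (ψ := ψ) (χ := χ)) hA.linearIndependent i hu
  refine ⟨_, ⟨fun m k => ?_, l1⟩, ?_, ?_⟩
  · by_cases hm : m = i
    · subst hm
      rw [Function.update_self, supVal_mul, hvu, inv_mul_le_one₀ (zero_lt_iff.2 h0)]
      exact hj k (Finset.mem_univ _)
    · rw [Function.update_of_ne hm]
      exact hA.supVal_le _ _
  · rw [detWidth, e2, width_single _ one_ne_zero, one_mul]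
  · rw [detVal, detVal, e1, oreValuation_toMonoidWithZeroHom, hvu]
    have h1 := rowDet_ne_zero (oreValuation_neg_one (ψ := ψ)) hA.linearIndependent
    have h2 : 1 < (supVal ψ (A i j))⁻¹ := (one_lt_inv₀ (zero_lt_iff.2 h0)).2 (hi j)
    exact lt_mul_of_one_lt_left (zero_lt_iff.2 h1) h2

theorem one_le_detWidth_of_isAdmissible {n : ℕ} (A : Fin n → Fin n → TwistedGroupRing σ)
    (hA : IsAdmissible ψ A) : 1 ≤ detWidth ψ χ A := by
  have hv1 := oreValuation_neg_one (σ := σ) (ψ := ψ)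
  have hw1 := width_neg_one (σ := σ) (ψ := ψ) (χ := χ)
  obtain ⟨N, hN⟩ : ∃ N, N = (-WithZero.log (detVal ψ A)).toNat := ⟨_, rfl⟩
  induction N using Nat.strong_induction_on generalizing A with
  | _ N ihN =>
  have hle : ∀ B : Fin n → Fin n → TwistedGroupRing σ, IsAdmissible ψ B →
      detVal ψ B ≤ 1 ∧ detVal ψ B ≠ 0 := fun B hB =>
    ⟨rowDet_valuation_le_one _ hB.linearIndependent fun i j =>
      (oreValuation_toOreField _).trans_le (hB.supVal_le i j),
      rowDet_ne_zero hv1 hB.linearIndependent⟩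
  suffices h : ∀ (d : ℕ) (B : Fin n → Fin n → TwistedGroupRing σ) (r k : ℕ),
      IsAdmissible ψ B → detVal ψ B = detVal ψ A → IsEchelon ψ B r k → k + d = n →
      1 ≤ detWidth ψ χ B from
    h n A 0 0 hA rfl ⟨le_rfl, fun _ _ _ h => absurd h (Nat.not_lt_zero _),
      fun _ _ h => absurd h (Nat.not_lt_zero _), fun _ _ _ h => absurd h (Nat.not_lt_zero _)⟩
      (Nat.zero_add n)
  intro d
  induction d with
  | zero =>
    intro B r k hB hBA hE hk
    rw [Nat.add_zero] at hk
    subst hk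
    rcases hE.le.lt_or_eq with hr | hr
    · obtain ⟨B', hB', hw, hv⟩ := hB.exists_detVal_lt (χ := χ) ⟨r, hr⟩
        fun j => hE.below _ j le_rfl j.2
      rw [← hw]
      refine ihN _ ?_ B' hB' rfl
      rw [hN, ← hBA]
      have h1 := (WithZero.log_lt_log (hle B hB).2 (hle B' hB').2).2 hv
      have h2 := (WithZero.log_le_log (hle B' hB').2 one_ne_zero).2 (hle B' hB').1
      rw [WithZero.log_one] at h2
      omega
    · have e := map_dieudonneRep_of_triangular (oreValuation σ ψ) (w := width σ ψ χ)
        (A := Matrix.of fun i j => toOreField σ (B i j)) (fun x y h => width_add_of_lt h)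
        (fun i j => (oreValuation_toOreField _).trans_le (hB.supVal_le i j))
        (fun i => (oreValuation_toOreField _).trans (hE.diag hr i i.2))
        (fun i j hij => (oreValuation_toOreField _).trans_lt (hE.triangular hr i j j.2 hij))
      refine le_of_le_of_eq ?_ ((rowDet_eq_map_dieudonneRep hw1 hB.linearIndependent).trans e).symm
      · refine Finset.one_le_prod' fun i _ => one_le_width ψ χ fun h0 => ?_
        have := hE.diag hr i i.2
        rw [h0, supVal_zero] at this
        exact zero_ne_one this
  | succ d ihd =>
    intro B r k hB hBA hE hk
    have hkn : k < n := by omega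
    let κ : Fin n := ⟨k, hkn⟩
    obtain ⟨m, hm⟩ : ∃ m, m = ∑ i ∈ Finset.univ.filter (fun i : Fin n => r ≤ i),
      residueSize ψ χ (B i κ) := ⟨_, rfl⟩
    induction m using Nat.strong_induction_on generalizing B with
    | _ m ihm =>
    by_cases h0 : ∀ i : Fin n, r ≤ i → supVal ψ (B i κ) < 1
    · refine ihd B r (k + 1) hB hBA ⟨hE.le.trans (Nat.le_succ k), fun i j hi hj => ?_,
        fun h => ?_, fun h => ?_⟩ (by omega)
      · rcases Nat.lt_succ_iff_lt_or_eq.1 hj with hj | hj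
        · exact hE.below i j hi hj
        · obtain rfl : j = κ := Fin.ext hj
          exact h0 i hi
      · have := hE.le; omega
      · have := hE.le; omega
    push Not at h0
    obtain ⟨i, hi, hi1⟩ := h0
    have hi1 : supVal ψ (B i κ) = 1 := le_antisymm (hB.supVal_le _ _) hi1
    by_cases h1 : ∀ j : Fin n, r ≤ j → j ≠ i → supVal ψ (B j κ) < 1
    · let ρ : Fin n := ⟨r, hi.trans_lt i.2⟩
      have hlt : ∀ j : Fin n, r < j → r ≤ Equiv.swap ρ i j ∧ Equiv.swap ρ i j ≠ i := by
        intro j hj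
        have hjρ : j ≠ ρ := fun h => by simp [h, ρ] at hj
        by_cases hji : j = i
        · rw [hji, Equiv.swap_apply_right]
          exact ⟨le_rfl, fun h => hjρ (hji.trans h.symm)⟩
        · rw [Equiv.swap_apply_of_ne_of_ne hjρ hji]
          exact ⟨hj.le, hji⟩
      have hle' : ∀ j : Fin n, r ≤ j → r ≤ Equiv.swap ρ i j := by
        intro j hj
        rcases hj.lt_or_eq with hj | hj
        · exact (hlt j hj).1
        · obtain rfl : ρ = j := Fin.ext hj
          rwa [Equiv.swap_apply_left]
      have hsm : ∀ j : Fin n, (j : ℕ) < r → Equiv.swap ρ i j = j := fun j hj =>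
        Equiv.swap_apply_of_ne_of_ne (fun h => by simp [h, ρ] at hj)
          (fun h => by rw [h] at hj; omega)
      have hb : ∀ a j : Fin n, r < a → (j : ℕ) < k + 1 →
          supVal ψ ((B ∘ Equiv.swap ρ i) a j) < 1 := by
        intro a j ha hj
        rcases Nat.lt_succ_iff_lt_or_eq.1 hj with hj | hj
        · exact hE.below _ j (hlt a ha).1 hj
        · obtain rfl : j = κ := Fin.ext hj
          exact h1 _ (hlt a ha).1 (hlt a ha).2
      have hw2 : detWidth ψ χ (B ∘ Equiv.swap ρ i) = detWidth ψ χ B :=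
        rowDet_comp_perm hw1 hB.linearIndependent _
      have hv2 : detVal ψ (B ∘ Equiv.swap ρ i) = detVal ψ B :=
        rowDet_comp_perm hv1 hB.linearIndependent _
      rw [← hw2]
      refine ihd _ (r + 1) (k + 1) (hB.comp_perm _) (hv2.trans hBA)
        ⟨Nat.succ_le_succ hE.le, hb, fun h j hj => ?_, fun h a j hj hja => ?_⟩ (by omega)
      · have hrk : r = k := Nat.succ_injective h
        rcases Nat.lt_succ_iff_lt_or_eq.1 hj with hj | hj
        · have := hsm j (hrk ▸ hj)
          rw [Function.comp_apply, this]
          exact hE.diag hrk j hj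
        · have e1 : j = κ := Fin.ext hj
          have e2 : j = ρ := Fin.ext (hj.trans hrk.symm)
          rw [Function.comp_apply]
          nth_rewrite 1 [e2]
          rw [Equiv.swap_apply_left, e1]
          exact hi1
      · have hrk : r = k := Nat.succ_injective h
        by_cases har : r < a
        · exact hb a j har hj
        · have har' : (j : ℕ) < a := hja
          rcases Nat.lt_or_ge a r with har2 | har2
          · rw [Function.comp_apply, hsm a har2]
            exact hE.triangular hrk a j (by omega) hja
          · exact hE.below _ j (hle' a har2) (by omega)
    · push Not at h1
      obtain ⟨j, hj, hji, hj1⟩ := h1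
      have hj1 : supVal ψ (B j κ) = 1 := le_antisymm (hB.supVal_le _ _) hj1
      have key : ∀ i j : Fin n, r ≤ i → r ≤ j → i ≠ j → supVal ψ (B i κ) = 1 →
          supVal ψ (B j κ) = 1 → width σ ψ χ (toOreField σ (B j κ)) ≤
            width σ ψ χ (toOreField σ (B i κ)) → 1 ≤ detWidth ψ χ B := by
        intro i j hi hj hij hi1 hj1 hw
        obtain ⟨q, p, hq, hvq, hwq, hp, hlt⟩ := exists_pseudo_division hi1 hj1 hw
        have hw2 := (rowDet_rowOp hw1 hB.linearIndependent hij hq p).1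
        have hv2 := (rowDet_rowOp hv1 hB.linearIndependent hij hq p).1
        rw [hwq, one_mul] at hw2
        rw [oreValuation_toMonoidWithZeroHom, hvq, one_mul] at hv2
        rw [detWidth, ← hw2]
        refine ihm _ ?_ (rowOp B i j q p) (hB.rowOp hij hq hvq hp) (hv2.trans hBA)
          (hE.rowOp hi hj hvq hp) rfl
        rw [hm]
        refine Finset.sum_lt_sum (fun a _ => ?_) ⟨i, by simpa using hi, ?_⟩
        · by_cases ha : a = i
          · subst ha
            simpa only [rowOp, Function.update_self] using hlt.le
          · simp only [rowOp, Function.update_of_ne ha, le_refl]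
        · simpa only [rowOp, Function.update_self] using hlt
      rcases le_total (width σ ψ χ (toOreField σ (B j κ))) (width σ ψ χ (toOreField σ (B i κ)))
        with hw | hw
      · exact key i j hi hj hji.symm hi1 hj1 hw
      · exact key j i hj hi hji hj1 hi1 hw

variable (ψ χ) in
/-- The width of the determinant of a matrix over the twisted group ring is non-negative. -/
theorem one_le_detWidth {n : ℕ} (A : Fin n → Fin n → TwistedGroupRing σ)
    (hA : LinearIndependent (OreField σ) fun i k => toOreField σ (A i k)) :
    1 ≤ detWidth ψ χ A := by
  by_cases h : ∀ i j, supVal ψ (A i j) ≤ 1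
  · exact one_le_detWidth_of_isAdmissible A ⟨h, hA⟩
  push Not at h
  obtain ⟨i₀, j₀, h₀⟩ := h
  obtain ⟨⟨i, j⟩, -, hij⟩ := Finset.exists_max_image Finset.univ
    (fun x : Fin n × Fin n => supVal ψ (A x.1 x.2)) ⟨(i₀, j₀), Finset.mem_univ _⟩
  have hAij : A i j ≠ 0 := fun h0 => by
    have := h₀.trans_le (hij (i₀, j₀) (Finset.mem_univ _))
    simp [h0, supVal_zero] at this
  obtain ⟨g, -, hg⟩ := exists_supVal_eq (ℓ := ψ) hAij
  have hu : single σ g⁻¹ (1 : R) ≠ 0 := single_ne_zero one_ne_zero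
  obtain ⟨e, l⟩ := rowDet_smul_rows (width_neg_one (ψ := ψ) (χ := χ)) hA (toOreField_ne_zero hu)
    (width_single _ one_ne_zero) Finset.univ
  have h1 : (fun k => if k ∈ Finset.univ then
      toOreField σ (single σ g⁻¹ (1 : R)) • (fun m => toOreField σ (A k m)) else
        fun m => toOreField σ (A k m)) =
      fun k m => toOreField σ (single σ g⁻¹ (1 : R) * A k m) := by
    funext k m
    simp
  rw [h1] at e l
  rw [detWidth, ← e]
  refine one_le_detWidth_of_isAdmissible (fun k m => single σ g⁻¹ (1 : R) * A k m)
    ⟨fun k m => ?_, l⟩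
  rw [supVal_mul, supVal_single one_ne_zero, map_inv, WithZero.coe_inv, ← hg,
    inv_mul_le_one₀ (zero_lt_iff.2 (supVal_ne_zero hAij))]
  exact hij (k, m) (Finset.mem_univ _)

variable (ψ χ) in
/-- The width of the determinant of an invertible matrix over the twisted group ring vanishes. -/
theorem width_dieudonneRep_eq_one {n : ℕ} {A B : Matrix (Fin n) (Fin n) (TwistedGroupRing σ)}
    (hAB : A * B = 1) (hBA : B * A = 1) :
    width σ ψ χ (dieudonneRep n (A.map (toOreField σ))) = 1 := by
  have hw1 := width_neg_one (σ := σ) (ψ := ψ) (χ := χ)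
  have h1 : A.map (toOreField σ) * B.map (toOreField σ) = 1 := by
    rw [← Matrix.map_mul, hAB, Matrix.map_one _ (map_zero _) (map_one _)]
  have h2 : B.map (toOreField σ) * A.map (toOreField σ) = 1 := by
    rw [← Matrix.map_mul, hBA, Matrix.map_one _ (map_zero _) (map_one _)]
  have lA := LinearIndependent.of_mul_eq_one h1
  have lB := LinearIndependent.of_mul_eq_one h2
  have h3 := rowDet_mul hw1 lA lB
  have h4 : (1 : Matrix (Fin n) (Fin n) (OreField σ)) = fun i => Pi.single i 1 := by
    ext i j
    simp [Matrix.one_apply, Pi.single_apply, eq_comm]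
  rw [h1, h4, rowDet_single hw1] at h3
  have h5 := one_le_detWidth ψ χ A lA
  have h6 := one_le_detWidth ψ χ B lB
  rw [← rowDet_eq_map_dieudonneRep hw1 lA]
  refine le_antisymm ?_ h5
  calc _ ≤ _ := le_mul_of_one_le_right' h6
    _ = 1 := h3.symm

end Descent

end TwistedGroupRing

/-! ## Polytopes with equal widths -/

section FaceWidth

open Filter Topology

/-- On the face of `S` on which `u` is maximal, the difference between the largest and the smallest
value of `c` is `w`. -/
def FaceWidth {V K : Type*} [AddCommGroup K] [LinearOrder K] (S : Finset V) (u c : V → K)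
    (w : K) : Prop :=
  ∃ a b d : K, b - d = w ∧ (∀ x ∈ S, u x ≤ a) ∧ (∀ x ∈ S, u x = a → d ≤ c x ∧ c x ≤ b) ∧
    (∃ x ∈ S, u x = a ∧ c x = b) ∧ ∃ x ∈ S, u x = a ∧ c x = d

theorem faceWidth_zero {V K : Type*} [AddCommGroup K] [LinearOrder K] {S : Finset V}
    (hS : S.Nonempty) {u c : V → K} (h : ∀ x ∈ S, ∀ y ∈ S, u x = u y → c x = c y) :
    FaceWidth S u c 0 := by
  obtain ⟨x, hx, hxm⟩ := S.exists_max_image u hS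
  exact ⟨u x, c x, c x, sub_self _, hxm, fun y hy e => ⟨(h y hy x hx e).ge, (h y hy x hx e).le⟩,
    ⟨x, hx, rfl, rfl⟩, ⟨x, hx, rfl, rfl⟩⟩

theorem FaceWidth.eventually_sup' {V : Type*} {S : Finset V} (hS : S.Nonempty) {u c : V → ℝ}
    {t₀ w : ℝ} (h : FaceWidth S (fun x => u x + t₀ * c x) c w) :
    ∃ b d : ℝ, b - d = w ∧ ∀ᶠ t in 𝓝 t₀, S.sup' hS (fun x => u x + t * c x) =
      S.sup' hS (fun x => u x + t₀ * c x) + max (b * (t - t₀)) (d * (t - t₀)) := by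
  obtain ⟨a, b, d, hw, ha, hbd, ⟨x, hx, hxa, hxb⟩, ⟨y, hy, hya, hyd⟩⟩ := h
  refine ⟨b, d, hw, ?_⟩
  have ha' : S.sup' hS (fun x => u x + t₀ * c x) = a :=
    le_antisymm (Finset.sup'_le _ _ ha) (hxa ▸ Finset.le_sup' (fun x => u x + t₀ * c x) hx)
  have hev : ∀ᶠ t in 𝓝 t₀, ∀ z ∈ S, u z + t₀ * c z < a →
      u z + t * c z < a + b * (t - t₀) := by
    rw [Filter.eventually_all_finset]
    intro z _
    by_cases hz : u z + t₀ * c z < a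
    · have h1 : ContinuousAt (fun t => u z + t * c z) t₀ := by fun_prop
      have h2 : ContinuousAt (fun t => a + b * (t - t₀)) t₀ := by fun_prop
      filter_upwards [h1.eventually_lt h2 (by simpa using hz)] with t ht _ using ht
    · exact Eventually.of_forall fun t h => absurd h hz
  filter_upwards [hev] with t ht
  rw [ha']
  refine le_antisymm (Finset.sup'_le _ _ fun z hz => ?_) ?_
  · rcases (ha z hz).lt_or_eq with h | h
    · exact (ht z hz h).le.trans (add_le_add_right (le_max_left _ _) _)
    · obtain ⟨h1, h2⟩ := hbd z hz h
      have e : u z + t * c z = a + c z * (t - t₀) := by rw [← h]; ring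
      rw [e]
      refine add_le_add_right ?_ _
      rcases le_total t₀ t with h3 | h3
      · exact le_max_of_le_left (mul_le_mul_of_nonneg_right h2 (sub_nonneg.2 h3))
      · exact le_max_of_le_right (mul_le_mul_of_nonpos_right h1 (sub_nonpos.2 h3))
  · have e1 : u x + t * c x = a + b * (t - t₀) := by rw [← hxa, ← hxb]; ring
    have e2 : u y + t * c y = a + d * (t - t₀) := by rw [← hya, ← hyd]; ring
    rw [← max_add_add_left, ← e1, ← e2]
    exact max_le (Finset.le_sup' (fun x => u x + t * c x) hx)
      (Finset.le_sup' (fun x => u x + t * c x) hy)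

theorem exists_affine_of_locally_affine {g : ℝ → ℝ}
    (h : ∀ t₀, ∃ c, ∀ᶠ t in 𝓝 t₀, g t = g t₀ + c * (t - t₀)) :
    ∃ c, ∀ t, g t = g 0 + c * t := by
  choose c hc using h
  have haff : ∀ a b e t : ℝ, HasDerivAt (fun t => a + b * (t - e)) b t := fun a b e t => by
    simpa using (((hasDerivAt_id t).sub_const e).const_mul b).const_add a
  have hd : ∀ t, HasDerivAt g (c t) t := fun t =>
    (haff (g t) (c t) t t).congr_of_eventuallyEq (hc t)
  have hconst : IsLocallyConstant c := by
    rw [IsLocallyConstant.iff_eventually_eq]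
    intro t₀
    filter_upwards [(hc t₀).eventually_nhds] with t ht
    exact (hd t).unique ((haff (g t₀) (c t₀) t₀ t).congr_of_eventuallyEq ht)
  refine ⟨c 0, fun t => ?_⟩
  have h1 : ∀ s, HasDerivAt (fun t => g t - c 0 * t) 0 s := fun s => by
    have := (hd s).sub ((hasDerivAt_id s).const_mul (c 0))
    rw [hconst.apply_eq_of_preconnectedSpace s 0] at this
    simp only [id_eq, mul_one, sub_self] at this
    exact this
  have h2 := is_const_of_deriv_eq_zero (fun s => (h1 s).differentiableAt)
    (fun s => (h1 s).deriv) t 0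
  simp only [mul_zero, sub_zero] at h2
  linarith

theorem abs_sup'_sub_le {V : Type*} {S : Finset V} (hS : S.Nonempty) (u c : V → ℝ) :
    ∃ C, ∀ t, 0 ≤ t → |S.sup' hS (fun x => u x + t * c x) - t * S.sup' hS c| ≤ C := by
  refine ⟨S.sup' hS fun x => |u x|, fun t ht => ?_⟩
  obtain ⟨x, hx, hxe⟩ := S.exists_mem_eq_sup' hS c
  obtain ⟨y, hy, hye⟩ := S.exists_mem_eq_sup' hS fun x => u x + t * c x
  have h1 := Finset.le_sup' (fun x => |u x|) hx
  have h2 := Finset.le_sup' (fun x => |u x|) hy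
  have h3 := Finset.le_sup' (fun x => u x + t * c x) hx
  have h4 := mul_le_mul_of_nonneg_left (Finset.le_sup' c hy) ht
  rw [abs_le]
  constructor
  · rw [hxe]
    have := neg_abs_le (u x)
    linarith
  · rw [hye]
    have := le_abs_self (u y)
    linarith

theorem sup'_add_of_faceWidth {V : Type*} {S T : Finset V} (hS : S.Nonempty) (hT : T.Nonempty)
    {u c : V → ℝ} (h : ∀ t : ℝ, ∃ w, FaceWidth S (fun x => u x + t * c x) c w ∧
      FaceWidth T (fun x => u x + t * c x) c w) :
    S.sup' hS (fun x => u x + c x) - T.sup' hT (fun x => u x + c x) =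
      (S.sup' hS u - T.sup' hT u) + (S.sup' hS c - T.sup' hT c) := by
  let g : ℝ → ℝ := fun t => S.sup' hS (fun x => u x + t * c x) - T.sup' hT fun x => u x + t * c x
  obtain ⟨k, hk⟩ : ∃ k, ∀ t, g t = g 0 + k * t := by
    refine exists_affine_of_locally_affine fun t₀ => ?_
    obtain ⟨w, h1, h2⟩ := h t₀
    obtain ⟨b, d, hbd, e⟩ := h1.eventually_sup' hS
    obtain ⟨b', d', hbd', e'⟩ := h2.eventually_sup' hT
    refine ⟨b - b', ?_⟩
    filter_upwards [e, e'] with t ht ht'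
    have h3 : max (b * (t - t₀)) (d * (t - t₀)) =
        max (b' * (t - t₀)) (d' * (t - t₀)) + (b - b') * (t - t₀) := by
      have hd : d = d' + (b - b') := by linarith
      rw [← max_add_add_right, hd]
      congr 1 <;> ring
    simp only [g]
    rw [ht, ht', h3]
    ring
  obtain ⟨C, hC⟩ := abs_sup'_sub_le hS u c
  obtain ⟨C', hC'⟩ := abs_sup'_sub_le hT u c
  have hkc : k = S.sup' hS c - T.sup' hT c := by
    by_contra hne
    have hpos : 0 < |k - (S.sup' hS c - T.sup' hT c)| := abs_pos.2 (sub_ne_zero.2 hne)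
    obtain ⟨N, hN⟩ := exists_nat_gt ((C + C' + |g 0|) / |k - (S.sup' hS c - T.sup' hT c)|)
    rw [div_lt_iff₀ hpos] at hN
    have h1 := hC N (Nat.cast_nonneg N)
    have h2 := hC' N (Nat.cast_nonneg N)
    have h3 : (N : ℝ) * (k - (S.sup' hS c - T.sup' hT c)) =
        (S.sup' hS (fun x => u x + N * c x) - N * S.sup' hS c) -
          (T.sup' hT (fun x => u x + N * c x) - N * T.sup' hT c) - g 0 := by
      have := hk N
      simp only [g] at this ⊢
      linarith
    have h4 : (N : ℝ) * |k - (S.sup' hS c - T.sup' hT c)| ≤ C + C' + |g 0| := by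
      have h5 : (N : ℝ) * |k - (S.sup' hS c - T.sup' hT c)| =
          |(N : ℝ) * (k - (S.sup' hS c - T.sup' hT c))| := by
        rw [abs_mul, abs_of_nonneg (Nat.cast_nonneg N : (0 : ℝ) ≤ N)]
      rw [h5, h3]
      exact (abs_sub _ _).trans (add_le_add_left ((abs_sub _ _).trans (add_le_add h1 h2)) _)
    linarith
  have h1 := hk 1
  simp only [g, one_mul, zero_mul, add_zero, mul_one] at h1
  rw [h1, hkc]

end FaceWidth

section Lattice

variable {M : Type*} [AddCommGroup M]

theorem FaceWidth.cast_div {S : Finset M} {ψ χ : M →ₗ[ℤ] ℤ} {k m w : ℤ} (hk : 0 < k)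
    (h : FaceWidth S (k • ψ + m • χ) χ w) :
    FaceWidth S (fun x => (ψ x : ℝ) + (m / k : ℝ) * χ x) (fun x => (χ x : ℝ)) w := by
  obtain ⟨a, b, d, hw, ha, hbd, ⟨x, hx, hxa, hxb⟩, ⟨y, hy, hya, hyd⟩⟩ := h
  have hk' : (0 : ℝ) < k := by exact_mod_cast hk
  have e : ∀ z, (ψ z : ℝ) + (m / k : ℝ) * χ z = (((k • ψ + m • χ) z : ℤ) : ℝ) / k := fun z => by
    simp only [LinearMap.add_apply, LinearMap.smul_apply, smul_eq_mul]
    push_cast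
    field_simp
  have e2 : ∀ z, (((k • ψ + m • χ) z : ℤ) : ℝ) / k = (a : ℝ) / k ↔ (k • ψ + m • χ) z = a :=
    fun z => by
      rw [div_left_inj' hk'.ne']
      exact_mod_cast Iff.rfl
  refine ⟨(a : ℝ) / k, b, d, by exact_mod_cast hw, fun z hz => ?_, fun z hz hza => ?_,
    ⟨x, hx, ?_, congrArg Int.cast hxb⟩, ⟨y, hy, ?_, congrArg Int.cast hyd⟩⟩
  · refine (e z).trans_le ?_
    have : (((k • ψ + m • χ) z : ℤ) : ℝ) ≤ a := by exact_mod_cast ha z hz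
    exact div_le_div_of_nonneg_right this hk'.le
  · simp only [e, e2] at hza
    have := hbd z hz hza
    exact ⟨Int.cast_le.2 this.1, Int.cast_le.2 this.2⟩
  · simp only [e, e2]
    exact hxa
  · simp only [e, e2]
    exact hya

theorem sup'_intCast {V : Type*} {S : Finset V} (hS : S.Nonempty) (ψ : V → ℤ) :
    S.sup' hS (fun x => (ψ x : ℝ)) = ((S.sup' hS ψ : ℤ) : ℝ) :=
  (Finset.apply_sup'_eq_sup'_comp hS (fun n : ℤ => (n : ℝ)) fun a b => by push_cast; rfl).symm

theorem sup'_sub_sup'_add {S T : Finset M} (hS : S.Nonempty) (hT : T.Nonempty)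
    (h : ∀ ψ χ : M →ₗ[ℤ] ℤ, ∃ w : ℤ, FaceWidth S ψ χ w ∧ FaceWidth T ψ χ w) (ψ χ : M →ₗ[ℤ] ℤ) :
    S.sup' hS (ψ + χ : M →ₗ[ℤ] ℤ) - T.sup' hT (ψ + χ : M →ₗ[ℤ] ℤ) =
      (S.sup' hS ψ - T.sup' hT ψ) + (S.sup' hS χ - T.sup' hT χ) := by
  have key := sup'_add_of_faceWidth hS hT (u := fun x => (ψ x : ℝ)) (c := fun x => (χ x : ℝ)) ?_
  · have e : (fun x => (ψ x : ℝ) + (χ x : ℝ)) = fun x => (((ψ + χ : M →ₗ[ℤ] ℤ) x : ℤ) : ℝ) := by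
      funext x
      simp
    rw [e] at key
    simp only [sup'_intCast] at key
    exact_mod_cast key
  · intro t
    by_cases ht : Irrational t
    · have h0 : ∀ x y, (ψ x : ℝ) + t * χ x = ψ y + t * χ y → (χ x : ℝ) = χ y := by
        intro x y e
        by_contra hne
        have hne' : (χ y : ℝ) - χ x ≠ 0 := sub_ne_zero.2 (Ne.symm hne)
        refine ht ⟨((ψ x - ψ y : ℤ) : ℚ) / ((χ y - χ x : ℤ) : ℚ), ?_⟩
        push_cast
        rw [div_eq_iff hne']
        linarith
      exact ⟨0, faceWidth_zero hS fun x _ y _ e => h0 x y e,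
        faceWidth_zero hT fun x _ y _ e => h0 x y e⟩
    · rw [Irrational, not_not] at ht
      obtain ⟨r, rfl⟩ := ht
      obtain ⟨w, h1, h2⟩ := h ((r.den : ℤ) • ψ + r.num • χ) χ
      have hr : (r : ℝ) = (r.num : ℝ) / ((r.den : ℤ) : ℝ) := by
        rw [Int.cast_natCast]; exact_mod_cast (Rat.num_div_den r).symm
      have hpos : (0 : ℤ) < r.den := by exact_mod_cast r.den_pos
      rw [hr]
      exact ⟨w, h1.cast_div hpos, h2.cast_div hpos⟩

theorem exists_sup'_eq_add [Module.Free ℤ M] [Module.Finite ℤ M] {S T : Finset M}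
    (hS : S.Nonempty) (hT : T.Nonempty)
    (h : ∀ ψ χ : M →ₗ[ℤ] ℤ, ∃ w : ℤ, FaceWidth S ψ χ w ∧ FaceWidth T ψ χ w) :
    ∃ g : M, ∀ ψ : M →ₗ[ℤ] ℤ, S.sup' hS ψ = T.sup' hT ψ + ψ g := by
  let f : Module.Dual ℤ M →+ ℤ := AddMonoidHom.mk' (fun ψ => S.sup' hS ψ - T.sup' hT ψ)
    (sup'_sub_sup'_add hS hT h)
  refine ⟨(Module.evalEquiv ℤ M).symm f.toIntLinearMap, fun ψ => ?_⟩
  have h1 := Module.apply_evalEquiv_symm_apply ℤ M ψ f.toIntLinearMap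
  rw [h1]
  change _ = _ + (S.sup' hS ψ - T.sup' hT ψ)
  ring

theorem denseRange_ratCast_pi (ι : Type*) : DenseRange fun (r : ι → ℚ) i => (r i : ℝ) :=
  DenseRange.piMap fun _ => Rat.denseRange_cast

theorem exists_int_functional_of_real {ι : Type*} [Fintype ι] {T : Finset (ι → ℤ)} {φ : ι → ℝ}
    (h : ∀ y ∈ T, 0 < ∑ i, φ i * (y i : ℝ)) :
    ∃ k : ι → ℤ, ∀ y ∈ T, 0 < ∑ i, k i * y i := by
  have hopen : IsOpen {φ : ι → ℝ | ∀ y ∈ T, 0 < ∑ i, φ i * (y i : ℝ)} := by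
    have : {φ : ι → ℝ | ∀ y ∈ T, 0 < ∑ i, φ i * (y i : ℝ)} =
        ⋂ y ∈ T, {φ : ι → ℝ | 0 < ∑ i, φ i * (y i : ℝ)} := by
      ext; simp
    rw [this]
    exact isOpen_biInter_finset fun y _ => isOpen_lt continuous_const (by fun_prop)
  obtain ⟨r, hr⟩ := (denseRange_ratCast_pi ι).exists_mem_open hopen ⟨φ, h⟩
  let N : ℕ := ∏ i, (r i).den
  have hN : 0 < N := Finset.prod_pos fun i _ => (r i).den_pos
  have hk : ∀ i, ∃ k : ℤ, (k : ℚ) = N * r i := fun i => by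
    obtain ⟨c, hc⟩ := Finset.dvd_prod_of_mem (fun i => (r i).den) (Finset.mem_univ i)
    refine ⟨c * (r i).num, ?_⟩
    have : N = (r i).den * c := hc
    rw [this]
    push_cast
    rw [mul_comm ((r i).den : ℚ), mul_assoc, Rat.den_mul_eq_num]
  choose k hk using hk
  refine ⟨k, fun y hy => ?_⟩
  have h1 : 0 < ∑ i, (r i : ℝ) * (y i : ℝ) := hr y hy
  have h2 : ((∑ i, k i * y i : ℤ) : ℝ) = N * ∑ i, (r i : ℝ) * (y i : ℝ) := by
    push_cast
    rw [Finset.mul_sum]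
    refine Finset.sum_congr rfl fun i _ => ?_
    have : (k i : ℝ) = N * (r i : ℝ) := by exact_mod_cast congrArg (fun q : ℚ => (q : ℝ)) (hk i)
    rw [this, mul_assoc]
  have h3 : (0 : ℝ) < N := by exact_mod_cast hN
  have h4 : (0 : ℝ) < ((∑ i, k i * y i : ℤ) : ℝ) := by
    rw [h2]
    exact mul_pos h3 h1
  exact_mod_cast h4

end Lattice

section Polytope

variable {H : Type*} [CommGroup H]

theorem latticePoint_mul (x y : H) : latticePoint (x * y) = latticePoint x + latticePoint y := by
  simp [latticePoint, TensorProduct.tmul_add]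

variable [Module.Free ℤ (Additive H)] [Module.Finite ℤ (Additive H)]

/-- Membership of lattice points in integral polytopes can be tested on integral functionals. -/
theorem latticePoint_mem_convexHull {T : Finset H} {x : H}
    (h : ∀ ψ : Additive H →ₗ[ℤ] ℤ, ∃ y ∈ T, ψ (Additive.ofMul x) ≤ ψ (Additive.ofMul y)) :
    latticePoint x ∈ convexHull ℝ (latticePoint '' (T : Set H)) := by
  classical
  let b := Module.Free.chooseBasis ℤ (Additive H)
  let E : RealHomology H ≃ₗ[ℝ] (Module.Free.ChooseBasisIndex ℤ (Additive H) → ℝ) :=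
    (b.baseChange ℝ).equivFun
  have hE : ∀ (y : H) i, E (latticePoint y) i = (b.repr (Additive.ofMul y) i : ℝ) := fun y i => by
    simp [E, latticePoint]
  by_contra hx
  have hx2 : E (latticePoint x) ∉ convexHull ℝ (E '' (latticePoint '' (T : Set H))) := by
    have h1 := E.toLinearMap.image_convexHull (latticePoint '' (T : Set H))
    simp only [LinearEquiv.coe_coe] at h1
    rw [← h1]
    rintro ⟨z, hz, e⟩
    rw [E.injective e] at hz
    exact hx hz
  have hfin : (E '' (latticePoint '' (T : Set H))).Finite := (T.finite_toSet.image _).image _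
  obtain ⟨f, u, hfx, hfu⟩ := geometric_hahn_banach_point_closed (convex_convexHull ℝ _)
    (hfin.isClosed_convexHull ℝ) hx2
  let z : H → Module.Free.ChooseBasisIndex ℤ (Additive H) → ℤ := fun y i =>
    b.repr (Additive.ofMul y) i - b.repr (Additive.ofMul x) i
  obtain ⟨k, hk⟩ := exists_int_functional_of_real (T := T.image z)
    (φ := fun i => f (Pi.single i 1)) (by
      intro w hw
      obtain ⟨y, hy, rfl⟩ := Finset.mem_image.1 hw
      have h2 : u < f (E (latticePoint y)) :=
        hfu _ (subset_convexHull ℝ _ ⟨_, ⟨y, hy, rfl⟩, rfl⟩)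
      have h3 : ∑ i, f (Pi.single i 1) * (z y i : ℝ) =
          f (E (latticePoint y)) - f (E (latticePoint x)) := by
        rw [← map_sub]
        conv_rhs => rw [pi_eq_sum_univ' (E (latticePoint y) - E (latticePoint x)), map_sum]
        refine Finset.sum_congr rfl fun i _ => ?_
        have h4 : (fun j => if i = j then (1 : ℝ) else 0) = Pi.single i 1 := by
          ext j; simp [Pi.single_apply, eq_comm]
        rw [map_smul, smul_eq_mul, mul_comm, Pi.sub_apply, hE, hE]
        simp [z]
      rw [h3]
      linarith)
  obtain ⟨y, hy, hle⟩ := h (-∑ i, k i • b.coord i)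
  rw [LinearMap.neg_apply, LinearMap.neg_apply] at hle
  have h5 := hk (z y) (Finset.mem_image_of_mem _ hy)
  have h6 : ∑ i, k i * z y i = (∑ i, k i • b.coord i) (Additive.ofMul y) -
      (∑ i, k i • b.coord i) (Additive.ofMul x) := by
    simp [z, LinearMap.sum_apply, mul_sub, Finset.sum_sub_distrib]
  linarith

open Additive in
theorem exists_convexHull_eq_add {S T : Finset H} (hS : S.Nonempty) (hT : T.Nonempty)
    (h : ∀ ψ χ : Additive H →ₗ[ℤ] ℤ, ∃ w : ℤ,
      FaceWidth S (fun x => ψ (ofMul x)) (fun x => χ (ofMul x)) w ∧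
      FaceWidth T (fun x => ψ (ofMul x)) (fun x => χ (ofMul x)) w) :
    ∃ g : H, convexHull ℝ (latticePoint '' (S : Set H)) =
      ({latticePoint g} : Set (RealHomology H)) +
        convexHull ℝ (latticePoint '' (T : Set H)) := by
  let S' : Finset (Additive H) := S
  let T' : Finset (Additive H) := T
  have hS' : S'.Nonempty := hS
  have hT' : T'.Nonempty := hT
  obtain ⟨g, hg⟩ := exists_sup'_eq_add hS' hT' h
  have key1 : ∀ x ∈ S, ∀ ψ : Additive H →ₗ[ℤ] ℤ, ∃ y ∈ T,
      ψ (ofMul (x * (toMul g)⁻¹)) ≤ ψ (ofMul y) := by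
    intro x hx ψ
    obtain ⟨y, hy, e⟩ := T'.exists_mem_eq_sup' hT' ψ
    refine ⟨toMul y, hy, ?_⟩
    have h1 : ψ (ofMul x) ≤ S'.sup' hS' ψ := Finset.le_sup' (s := S') ψ hx
    rw [hg, e] at h1
    rw [_root_.ofMul_mul, _root_.ofMul_inv, map_add, map_neg, ofMul_toMul, ofMul_toMul]
    linarith
  have key2 : ∀ y ∈ T, ∀ ψ : Additive H →ₗ[ℤ] ℤ, ∃ x ∈ S,
      ψ (ofMul (toMul g * y)) ≤ ψ (ofMul x) := by
    intro y hy ψ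
    obtain ⟨x, hx, e⟩ := S'.exists_mem_eq_sup' hS' ψ
    refine ⟨toMul x, hx, ?_⟩
    have h1 : ψ (ofMul y) ≤ T'.sup' hT' ψ := Finset.le_sup' (s := T') ψ hy
    have h2 := hg ψ
    rw [e] at h2
    rw [_root_.ofMul_mul, map_add, ofMul_toMul, ofMul_toMul]
    linarith
  refine ⟨toMul g, Set.Subset.antisymm (convexHull_min ?_ ?_) ?_⟩
  · rintro _ ⟨x, hx, rfl⟩
    refine ⟨_, rfl, _, latticePoint_mem_convexHull (key1 x hx), ?_⟩
    change latticePoint (toMul g) + latticePoint (x * (toMul g)⁻¹) = latticePoint x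
    rw [← latticePoint_mul, mul_comm x, mul_inv_cancel_left]
  · exact (convex_singleton _).add (convex_convexHull ℝ _)
  · rw [← convexHull_singleton (𝕜 := ℝ) (latticePoint (toMul g)), ← convexHull_add]
    refine convexHull_min ?_ (convex_convexHull ℝ _)
    rintro _ ⟨_, rfl, _, ⟨y, hy, rfl⟩, rfl⟩
    change latticePoint (toMul g) + latticePoint y ∈ _
    rw [← latticePoint_mul]
    exact latticePoint_mem_convexHull (key2 y hy)

end Polytope

/-! ## Newton polytopes of invertible matrices -/

section DieudonneClass

variable {D : Type*} [DivisionRing D]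

theorem map_eq_of_dieudonneClass_eq {C : Type*} [CommGroupWithZero C] (w : D →*₀ C) {x y : D}
    (h : dieudonneClass x = dieudonneClass y) : w x = w y := by
  classical
  by_cases hx : x = 0 <;> by_cases hy : y = 0
  · rw [hx, hy]
  · simp [dieudonneClass, hx, hy] at h
  · simp [dieudonneClass, hx, hy] at h
  · rw [dieudonneClass, dif_neg hx, dieudonneClass, dif_neg hy, WithZero.coe_inj] at h
    have h1 := congrArg (Abelianization.lift (Units.map (w : D →* C))) h
    rw [Abelianization.lift_apply_of, Abelianization.lift_apply_of] at h1
    exact congrArg Units.val h1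

theorem dieudonneClass_inv_mul {x y : D} (hx : x ≠ 0) (hy : y ≠ 0) :
    dieudonneClass (x⁻¹ * y) = dieudonneClass (y * x⁻¹) := by
  rw [dieudonneClass, dif_neg (mul_ne_zero (inv_ne_zero hx) hy), dieudonneClass,
    dif_neg (mul_ne_zero hy (inv_ne_zero hx)), WithZero.coe_inj]
  have h1 : Units.mk0 (x⁻¹ * y) (mul_ne_zero (inv_ne_zero hx) hy) =
      (Units.mk0 x hx)⁻¹ * Units.mk0 y hy := Units.ext (by simp)
  have h2 : Units.mk0 (y * x⁻¹) (mul_ne_zero hy (inv_ne_zero hx)) =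
      Units.mk0 y hy * (Units.mk0 x hx)⁻¹ := Units.ext (by simp)
  rw [h1, h2, map_mul, map_mul, mul_comm]

end DieudonneClass

namespace TwistedGroupRing

section Newton

open Multiplicative

variable {R H : Type*} [DivisionRing R] [CommGroup H] [IsMulTorsionFree H] [Group.FG H]
  {σ : StructureFunctions R H}

theorem faceWidth_support (ψ χ : H →* Multiplicative ℤ) {x : TwistedGroupRing σ} (hx : x ≠ 0) :
    ∃ w : ℤ, width σ ψ χ (toOreField σ x) = ↑(ofAdd w) ∧
      FaceWidth x.support (fun h => toAdd (ψ h)) (fun h => toAdd (χ h)) w := by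
  obtain ⟨a, b, c, h0, h1, h2, -⟩ := exists_supVal_lexHom ψ χ hx
  have face : ∀ (θ : H →* Multiplicative ℤ) (e : Multiplicative ℤ),
      supVal (lexHom ψ θ) x = ↑(toLex (a, e)) →
      (∀ h ∈ x.support, ψ h = a → θ h ≤ e) ∧ ∃ h ∈ x.support, ψ h = a ∧ θ h = e := by
    intro θ e he
    constructor
    · intro h hh hha
      have h3 := (le_supVal (ℓ := lexHom ψ θ) hh).trans_eq he
      rw [WithZero.coe_le_coe] at h3
      rcases Prod.Lex.toLex_le_toLex.1 h3 with h4 | h4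
      · exact absurd hha h4.ne
      · exact h4.2
    · obtain ⟨g, hg, hge⟩ := exists_supVal_eq (ℓ := lexHom ψ θ) hx
      rw [he, WithZero.coe_inj] at hge
      have h3 : (a, e) = (ψ g, θ g) := congrArg ofLex hge
      rw [Prod.mk.injEq] at h3
      exact ⟨g, hg, h3.1.symm, h3.2.symm⟩
  obtain ⟨f1, g, hg, hga, hgb⟩ := face χ b h1
  obtain ⟨f2, g', hg', hga', hgc⟩ := face χ⁻¹ c h2
  refine ⟨toAdd (b * c), width_toOreField_of_supVal h1 h2, toAdd a, toAdd b, -toAdd c,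
    sub_neg_eq_add _ _, fun h hh => ?_, fun h hh hha => ⟨?_, f1 h hh hha⟩,
    ⟨g, hg, hga, hgb⟩, ⟨g', hg', hga', ?_⟩⟩
  · have h3 := (le_supVal (ℓ := ψ) hh).trans_eq h0
    rw [WithZero.coe_le_coe] at h3
    exact h3
  · have h3 : -toAdd (χ h) ≤ toAdd c := f2 h hh hha
    linarith
  · have h3 : -toAdd (χ g') = toAdd c := hgc
    linarith

/-- Elements with the same widths have the same Newton polytopes, up to translation. -/
theorem exists_newtonPolytope_sub_eq {p q : TwistedGroupRing σ} (hp : p ≠ 0) (hq : q ≠ 0)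
    (h : ∀ ψ χ : H →* Multiplicative ℤ,
      width σ ψ χ (toOreField σ p) = width σ ψ χ (toOreField σ q)) :
    ∃ P : IntegralPolytope H, P.IsSingleton ∧
      (newtonPolytope p hp).toGroup - (newtonPolytope q hq).toGroup = P.toGroup := by
  obtain ⟨g, hg⟩ := exists_convexHull_eq_add (support_nonempty hp) (support_nonempty hq)
    fun ψ χ => by
      let ψ' : H →* Multiplicative ℤ := AddMonoidHom.toMultiplicativeRight ψ.toAddMonoidHom
      let χ' : H →* Multiplicative ℤ := AddMonoidHom.toMultiplicativeRight χ.toAddMonoidHom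
      obtain ⟨w, e, hw⟩ := faceWidth_support ψ' χ' hp
      obtain ⟨w', e', hw'⟩ := faceWidth_support ψ' χ' hq
      rw [h, e', WithZero.coe_inj] at e
      obtain rfl : w' = w := ofAdd.injective e
      exact ⟨w', hw, hw'⟩
  refine ⟨⟨convexHull ℝ (latticePoint '' (({g} : Finset H) : Set H)), {g}, by simp, rfl⟩,
    ⟨latticePoint g, by simp⟩, ?_⟩
  rw [sub_eq_iff_eq_add, IntegralPolytope.toGroup, IntegralPolytope.toGroup,
    IntegralPolytope.toGroup, ← map_add]
  congr 1
  refine Subtype.ext ?_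
  change convexHull ℝ (latticePoint '' (p.support : Set H)) =
    convexHull ℝ (latticePoint '' (({g} : Finset H) : Set H)) +
      convexHull ℝ (latticePoint '' (q.support : Set H))
  rw [hg]
  simp

theorem exists_isNewtonPolytope {x : OreField σ} (hx : x ≠ 0) :
    ∃ P, IsNewtonPolytope (dieudonneClass x) P := by
  obtain ⟨s, a, hs, rfl⟩ := exists_eq_inv_mul x
  have ha : a ≠ 0 := by
    rintro rfl
    simp at hx
  exact ⟨_, a, s, ha, hs, dieudonneClass_inv_mul (toOreField_ne_zero hs) (toOreField_ne_zero ha),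
    rfl⟩

theorem exists_isMatrixNewtonPolytope {n : ℕ} {A B : Matrix (Fin n) (Fin n) (TwistedGroupRing σ)}
    (hAB : A * B = 1) : ∃ P, IsMatrixNewtonPolytope A P := by
  refine exists_isNewtonPolytope fun h0 => ?_
  have h1 : A.map (toOreField σ) * B.map (toOreField σ) = 1 := by
    rw [← Matrix.map_mul, hAB, Matrix.map_one _ (map_zero _) (map_one _)]
  have lA := LinearIndependent.of_mul_eq_one h1
  have hw := width_neg_one (σ := σ) (ψ := 1) (χ := 1)
  have h2 := rowDet_ne_zero hw lA
  rw [rowDet_eq_map_dieudonneRep hw lA, h0, map_zero] at h2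
  exact h2 rfl

/-- The Newton polytope of an invertible matrix over the twisted group ring is a singleton. -/
theorem IsMatrixNewtonPolytope.exists_isSingleton {n : ℕ}
    {A B : Matrix (Fin n) (Fin n) (TwistedGroupRing σ)} (hAB : A * B = 1) (hBA : B * A = 1)
    {P : PolytopeGroup H} (hP : IsMatrixNewtonPolytope A P) :
    ∃ Q : IntegralPolytope H, Q.IsSingleton ∧ P = Q.toGroup := by
  obtain ⟨p, q, hp, hq, hd, rfl⟩ := hP
  refine exists_newtonPolytope_sub_eq hp hq fun ψ χ => ?_
  have h1 := map_eq_of_dieudonneClass_eq (width σ ψ χ) hd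
  rw [width_dieudonneRep_eq_one ψ χ hAB hBA, map_mul, map_inv₀] at h1
  exact (mul_inv_eq_one₀ ((map_ne_zero _).2 (toOreField_ne_zero hq))).1 h1.symm

end Newton

end TwistedGroupRing

/-! ## The main theorem -/

theorem WhiteheadGroup.exists_mk_eq {G : Type u} [Group G] (w : WhiteheadGroup G) :
    ∃ (n : ℕ) (A : GL (Fin n) (MonoidAlgebra ℤ G)), WhiteheadGroup.mk A = w := by
  obtain ⟨x, rfl⟩ := QuotientGroup.mk_surjective w
  obtain ⟨y, rfl⟩ := QuotientGroup.mk_surjective x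
  induction y using Quotient.inductionOn with
  | _ y => exact ⟨y.1, y.2, rfl⟩

/-- An embedding of `ℤG` into a skew field restricts to an equivariant embedding, with `G` acting
by conjugation. -/
noncomputable def EquivariantEmbedding.ofEmbedding {G : Type u} [Group G] {D : Type v}
    [DivisionRing D] (j : MonoidAlgebra ℤ G →+* D) (hj : Function.Injective j) :
    EquivariantEmbedding G D :=
  let unit : G →* Dˣ := (j.toMonoidHom.comp (MonoidAlgebra.of ℤ G)).toHomUnits
  { emb := j.comp (MonoidAlgebra.mapDomainRingHom ℤ (toFreeAb G).ker.subtype)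
    emb_injective := hj.comp
      (MonoidAlgebra.mapDomain_injective (Subgroup.subtype_injective _))
    act := (MulSemiringAction.toRingAut (ConjAct Dˣ) D).comp
      (ConjAct.toConjAct.toMonoidHom.comp unit)
    act_emb := fun g k => by
      have h1 : ∀ k : (toFreeAb G).ker, j.comp (MonoidAlgebra.mapDomainRingHom ℤ
          (toFreeAb G).ker.subtype) (MonoidAlgebra.of ℤ _ k) = unit k := fun k => by
        simp [unit, MonoidAlgebra.of_apply]
      rw [h1, h1]
      change ConjAct.toConjAct (unit g) • (unit k : D) = _
      rw [ConjAct.units_smul_def, ConjAct.ofConjAct_toConjAct, MulAut.conjNormal_apply, map_mul,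
        map_mul, map_inv]
      rfl
    act_ker := fun k a => by
      have h1 : j.comp (MonoidAlgebra.mapDomainRingHom ℤ
          (toFreeAb G).ker.subtype) (MonoidAlgebra.of ℤ _ k) = unit k := by
        simp [unit, MonoidAlgebra.of_apply]
      rw [h1]
      change ConjAct.toConjAct (unit k) • a = _
      rw [ConjAct.units_smul_def, ConjAct.ofConjAct_toConjAct, Units.val_inv_eq_inv_val] }

theorem mainTheorem8 {G : Type u} [Group G] (hG : IsAgrarian G) [Group.FG (Abelianization G)] :
    (∃ (𝕂 : Type u) (_ : DivisionRing 𝕂), Nonempty (EquivariantEmbedding G 𝕂)) ∧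
    ∀ (𝕂 : Type v) [DivisionRing 𝕂] (E : EquivariantEmbedding G 𝕂)
      (s : FreeAb G → G) (hs : ∀ h, toFreeAb G (s h) = h) (w : WhiteheadGroup G),
      (∃ x : PolytopeGroupT (FreeAb G), E.IsWhiteheadNewtonPolytope s hs w x) ∧
      ∀ x : PolytopeGroupT (FreeAb G), E.IsWhiteheadNewtonPolytope s hs w x → x.IsSingleton := by
  refine ⟨?_, fun 𝕂 _ E s hs w => ?_⟩
  · obtain ⟨D, hD, j, hj⟩ := hG
    exact ⟨D, hD, ⟨EquivariantEmbedding.ofEmbedding j hj⟩⟩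
  have hinv : ∀ {n : ℕ} (A : GL (Fin n) (MonoidAlgebra ℤ G)),
      (A : Matrix (Fin n) (Fin n) (MonoidAlgebra ℤ G)).map (E.groupRingHom s hs) *
        ((A⁻¹ : GL (Fin n) (MonoidAlgebra ℤ G)) :
          Matrix (Fin n) (Fin n) (MonoidAlgebra ℤ G)).map (E.groupRingHom s hs) = 1 := by
    intro n A
    rw [← Matrix.map_mul, Units.mul_inv, Matrix.map_one _ (map_zero _) (map_one _)]
  constructor
  · obtain ⟨n, A, rfl⟩ := WhiteheadGroup.exists_mk_eq w
    obtain ⟨P, hP⟩ := TwistedGroupRing.exists_isMatrixNewtonPolytope (hinv A)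
    exact ⟨_, n, A, P, rfl, hP, rfl⟩
  · rintro x ⟨n, A, P, -, hP, rfl⟩
    have h := hinv A⁻¹
    rw [inv_inv] at h
    obtain ⟨Q, hQ, rfl⟩ := hP.exists_isSingleton (hinv A) h
    exact ⟨Q, hQ, rfl⟩
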